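/- Let $M$ be a smooth manifold (Hausdorff, $\sigma$-compact, of dimension $n$), let $\mathbb T M=TM\oplus T^*M$ with the inner product $\langle X+\alpha,Y+\beta\rangle=\tfrac12(\alpha(Y)+\beta(X))$ and the Dorfman bracket $[\![X+\alpha,Y+\beta]\!]=[X,Y]+\mathcal L_X\beta-\iota_Y d\alpha$, and let sections $X+\alpha$ of $\mathbb T M$ act on differential forms by $\omega\mapsto \iota_X\omega+\alpha\wedge\omega$. A *generalized polynomial structure* of degree $N\ge 1$ with minimal polynomial $P$ is a smooth bundle endomorphism $\varphi$ of $\mathbb T M$, skew-symmetric for $\langle\cdot,\cdot\rangle$, such that the monic polynomial $P\in\mathbb R[x]$ of degree $N$ is the minimal polynomial of $\varphi_p:\mathbb T_pM\to\mathbb T_pM$ for every $p\in M$. Its eigenvalues are the complex eigenvalues of the $\varphi_p$. Let $\widetilde\varphi$ be the unique even $\mathbb R$-linear operator on differential forms with $[\widetilde\varphi,f]=0$ for all functions $f$, $[\widetilde\varphi,\mathbf x]=\varphi(\mathbf x)$ for all sections $\mathbf x$ of $\mathbb T M$, and $\widetilde\varphi(1)\in\Omega^2(M)$ (graded commutators of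 operators). Put $\delta_\varphi=P(\mathrm{ad}_{\widetilde\varphi})(d)$, where $d$ is the de Rham differential. The structure $\varphi$ is *minimal* if $[[\mathbf x,\delta_\varphi],\mathbf y]=0$ for all sections $\mathbf x,\mathbf y$ of $\mathbb T M$. The semisimple part $\varphi_s$ and the nilpotent part $\varphi_n$ of $\varphi$ are the bundle endomorphisms that give the Jordan–Chevalley decomposition $\varphi_p=(\varphi_s)_p+(\varphi_n)_p$ on every fibre. An endomorphism $\psi$ of $\mathbb T M$ is a *generalized Nijenhuis operator* if $$\psi^2[\![\mathbf x,\mathbf y]\!]+[\![\psi\mathbf x,\psi\mathbf y]\!]-\psi\big([\![\psi\mathbf x,\mathbf y]\!]+[\![\mathbf x,\psi\mathbf y]\!]\big)=0$$ for all sections $\mathbf x,\mathbf y$. (1) Let $\varphi$ be a generalized polynomial structure of degree $4$ with exactly two eigenvalues. Then $\varphi_s$ and $\varphi_n$ exist and are unique, and $\varphi$ is minimal if and only if $\varphi_s$ and $\varphi_n$ are both generalized Nijenhuis operators. (2) The map $\varphi\mapsto(\varphi_s,\varphi_n)$ is a bijection from the set of minimal generalized polynomial structures with minimal polynomial $(x^2+1)^2$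 onto the set of pairs $(\mathcal J_1,\mathcal J_2)$ with $\mathcal J_1\mathcal J_2=\mathcal J_2\mathcal J_1$, where $\mathcal J_1$ is a generalized complex structure (a skew-symmetric generalized Nijenhuis operator with $\mathcal J_1^2=-1$) and $\mathcal J_2$ is a weak generalized tangent structure (a generalized Nijenhuis operator that is a generalized polynomial structure with minimal polynomial $x^2$; thus $\mathcal J_2^2=0$ and $\mathcal J_2$ vanishes on no fibre, but the inclusion $\mathrm{Im}\,\mathcal J_2\subseteq\mathrm{Ker}\,\mathcal J_2$ may be strict). Its inverse is $(\mathcal J_1,\mathcal J_2)\mapsto\mathcal J_1+\mathcal J_2$. -/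

import Mathlib

open scoped ContDiff Manifold Polynomial TensorProduct

set_option linter.unusedSectionVars false

noncomputable section

namespace GenGeom

/-- The ring of smooth real functions on `M`. -/
abbrev SmoothFun (n : ℕ) (M : Type*) [TopologicalSpace M]
    [ChartedSpace (EuclideanSpace ℝ (Fin n)) M] : Type _ :=
  ContMDiffMap (𝓡 n) 𝓘(ℝ, ℝ) M ℝ ∞

/-- Smooth vector fields on `M`. -/
abbrev VField (n : ℕ) (M : Type*) [TopologicalSpace M]
    [ChartedSpace (EuclideanSpace ℝ (Fin n)) M] [IsManifold (𝓡 n) ∞ M] : Type _ :=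
  ContMDiffSection (𝓡 n) (EuclideanSpace ℝ (Fin n)) ∞ (TangentSpace (𝓡 n) : M → Type _)

section

variable {n : ℕ} {M : Type*} [TopologicalSpace M]
  [ChartedSpace (EuclideanSpace ℝ (Fin n)) M] [IsManifold (𝓡 n) ∞ M]

instance : SMul (SmoothFun n M) (VField n M) where
  smul f X := ⟨fun p => f p • X p, f.contMDiff.smul_section X.contMDiff⟩

theorem smul_apply (f : SmoothFun n M) (X : VField n M) (p : M) : (f • X) p = f p • X p := rfl

instance : Module (SmoothFun n M) (VField n M) where
  one_smul X := by ext p; simp [smul_apply]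
  mul_smul f g X := by ext p; simp [smul_apply, mul_smul]
  smul_zero f := by ext p; simp [smul_apply]
  smul_add f X Y := by ext p; simp [smul_apply]
  add_smul f g X := by ext p; simp [smul_apply, add_smul]
  zero_smul X := by ext p; simp [smul_apply]

instance : IsScalarTower ℝ (SmoothFun n M) (VField n M) where
  smul_assoc c f X := by ext p; simp [smul_apply, mul_smul]

/-- The directional derivative `X(f)` of a smooth function along a vector field. -/
def dirDeriv (X : VField n M) (f : SmoothFun n M) : SmoothFun n M where
  val p := mvfderiv (𝓡 n) f p (X p)
  property := by
    have h1 : ContMDiff (𝓡 n) 𝓘(ℝ, ℝ).tangent ∞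
        (fun p => tangentMap (𝓡 n) 𝓘(ℝ, ℝ) f (X p : TangentBundle (𝓡 n) M)) :=
      (f.contMDiff.contMDiff_tangentMap (m := ∞) (by simp)).comp X.contMDiff
    exact (contMDiff_snd_tangentBundle_modelSpace ℝ 𝓘(ℝ, ℝ)).comp h1

theorem dirDeriv_apply (X : VField n M) (f : SmoothFun n M) (p : M) :
    dirDeriv X f p = mvfderiv (𝓡 n) f p (X p) := rfl

theorem mdiffAt (f : SmoothFun n M) (p : M) : MDifferentiableAt (𝓡 n) 𝓘(ℝ, ℝ) f p :=
  (f.contMDiff p).mdifferentiableAt (by simp)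

theorem dirDeriv_add (X : VField n M) (f g : SmoothFun n M) :
    dirDeriv X (f + g) = dirDeriv X f + dirDeriv X g := by
  ext p
  simp [dirDeriv_apply, mvfderiv_add (mdiffAt f p) (mdiffAt g p)]

theorem dirDeriv_mul (X : VField n M) (f g : SmoothFun n M) :
    dirDeriv X (f * g) = f * dirDeriv X g + dirDeriv X f * g := by
  ext p
  simp [dirDeriv_apply, mvfderiv_mul (mdiffAt f p) (mdiffAt g p)]
  ring

theorem dirDeriv_add_left (X Y : VField n M) (f : SmoothFun n M) :
    dirDeriv (X + Y) f = dirDeriv X f + dirDeriv Y f := by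
  ext p; simp [dirDeriv_apply]

theorem dirDeriv_smul_left (g : SmoothFun n M) (X : VField n M) (f : SmoothFun n M) :
    dirDeriv (g • X) f = g * dirDeriv X f := by
  ext p; simp [dirDeriv_apply, smul_apply]

theorem dirDeriv_algebraMap (X : VField n M) (c : ℝ) :
    dirDeriv X (algebraMap ℝ (SmoothFun n M) c) = 0 := by
  ext p
  rw [dirDeriv_apply]
  have : (⇑(algebraMap ℝ (SmoothFun n M) c) : M → ℝ) = fun _ => c := by ext q; rfl
  rw [this, mvfderiv_const]; rfl

theorem dirDeriv_zero (X : VField n M) : dirDeriv X (0 : SmoothFun n M) = 0 := by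
  have := dirDeriv_algebraMap X 0
  rwa [map_zero] at this

theorem dirDeriv_const_smul (X : VField n M) (c : ℝ) (f : SmoothFun n M) :
    dirDeriv X (c • f) = c • dirDeriv X f := by
  rw [Algebra.smul_def, dirDeriv_mul, dirDeriv_algebraMap, zero_mul, add_zero, Algebra.smul_def]

/-- The Lie bracket of vector fields. -/
def lieBr (X Y : VField n M) : VField n M where
  toFun := VectorField.mlieBracket (𝓡 n) X Y
  contMDiff_toFun p :=
    have _h1 : IsManifold (𝓡 n) (minSmoothness ℝ 2) M := by
      rw [minSmoothness_of_isRCLikeNormedField]; infer_instance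
    have _h2 : IsManifold (𝓡 n) ((⊤ : ℕ∞) + 1) M := by
      have : ((⊤ : ℕ∞) : WithTop ℕ∞) + 1 = ∞ := by simp
      rw [this]; infer_instance
    ContMDiffAt.mlieBracket_vectorField (m := ⊤) (n := ⊤) (X.contMDiff p) (Y.contMDiff p) (by simp)

theorem lieBr_apply (X Y : VField n M) (p : M) :
    lieBr X Y p = VectorField.mlieBracket (𝓡 n) X Y p := rfl

theorem lieBr_self (X : VField n M) : lieBr X X = 0 := by
  ext p : 1; simp [lieBr_apply]

theorem lieBr_add_right (X Y Z : VField n M) : lieBr X (Y + Z) = lieBr X Y + lieBr X Z := by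
  ext p : 1
  exact VectorField.mlieBracket_add_right Y.mdifferentiableAt Z.mdifferentiableAt

theorem lieBr_smul_right (X : VField n M) (f : SmoothFun n M) (Y : VField n M) :
    lieBr X (f • Y) = f • lieBr X Y + dirDeriv X f • Y := by
  ext p : 1
  have := VectorField.mlieBracket_smul_right (I := 𝓡 n) (V := X) (W := Y) (mdiffAt f p)
    Y.mdifferentiableAt
  rw [add_comm]
  exact this

theorem lieBr_swap (X Y : VField n M) : lieBr X Y = - lieBr Y X := by
  ext p : 1
  exact VectorField.mlieBracket_swap_apply

theorem lieBr_add_left (X Y Z : VField n M) : lieBr (X + Y) Z = lieBr X Z + lieBr Y Z := by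
  rw [lieBr_swap, lieBr_add_right, lieBr_swap X, lieBr_swap Y]; abel

theorem lieBr_smul_left (f : SmoothFun n M) (X Y : VField n M) :
    lieBr (f • X) Y = f • lieBr X Y - dirDeriv Y f • X := by
  rw [lieBr_swap, lieBr_smul_right, lieBr_swap X, smul_neg]; abel

end

end GenGeom

end

noncomputable section

namespace GenGeom

/-- Differential `k`-forms on `M`: alternating `C^∞(M)`-multilinear functions of `k` smooth
vector fields with values in `C^∞(M)` (by tensoriality these are the same as smooth sections of
the bundle of alternating `k`-linear forms). -/
abbrev Form (n : ℕ) (M : Type*) [TopologicalSpace M]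
    [ChartedSpace (EuclideanSpace ℝ (Fin n)) M] [IsManifold (𝓡 n) ∞ M] (k : ℕ) : Type _ :=
  VField n M [⋀^Fin k]→ₗ[SmoothFun n M] SmoothFun n M

/-- Smooth `1`-forms, as `C^∞(M)`-linear functionals on vector fields. -/
abbrev OneForm (n : ℕ) (M : Type*) [TopologicalSpace M]
    [ChartedSpace (EuclideanSpace ℝ (Fin n)) M] [IsManifold (𝓡 n) ∞ M] : Type _ :=
  Module.Dual (SmoothFun n M) (VField n M)

section

variable {n : ℕ} {M : Type*} [TopologicalSpace M]
  [ChartedSpace (EuclideanSpace ℝ (Fin n)) M] [IsManifold (𝓡 n) ∞ M]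

/-- The differential of a function. -/
def dFun (f : SmoothFun n M) : OneForm n M where
  toFun X := dirDeriv X f
  map_add' X Y := dirDeriv_add_left X Y f
  map_smul' g X := dirDeriv_smul_left g X f

theorem dirDeriv_sum {ι : Type*} (s : Finset ι) (X : VField n M) (f : ι → SmoothFun n M) :
    dirDeriv X (∑ i ∈ s, f i) = ∑ i ∈ s, dirDeriv X (f i) := by
  classical
  induction s using Finset.induction_on with
  | empty => simp [dirDeriv_zero]
  | insert a s ha ih => rw [Finset.sum_insert ha, dirDeriv_add, ih, Finset.sum_insert ha]

/-- The Lie derivative of a form: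
`(L_X θ)(Y₁, …, Y_k) = X(θ(Y₁, …, Y_k)) - ∑ i, θ(Y₁, …, [X, Y_i], …, Y_k)`. -/
def lieDeriv {k : ℕ} (X : VField n M) (θ : Form n M k) : Form n M k where
  toFun Y := dirDeriv X (θ Y) - ∑ i, θ (Function.update Y i (lieBr X (Y i)))
  map_update_add' := by
    intro inst Y j A B
    obtain rfl : inst = instDecidableEqFin k := Subsingleton.elim _ _
    have key : ∀ i, θ (Function.update (Function.update Y j (A + B)) i
          (lieBr X (Function.update Y j (A + B) i))) =
        θ (Function.update (Function.update Y j A) i (lieBr X (Function.update Y j A i))) +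
        θ (Function.update (Function.update Y j B) i (lieBr X (Function.update Y j B i))) := by
      intro i
      by_cases h : i = j
      · subst h; simp [lieBr_add_right]
      · simp only [Function.update_of_ne h]
        rw [Function.update_comm (Ne.symm h), Function.update_comm (Ne.symm h),
          Function.update_comm (Ne.symm h), θ.map_update_add]
    simp only [key, Finset.sum_add_distrib, θ.map_update_add, dirDeriv_add]
    ring
  map_update_smul' := by
    intro inst Y j f A
    obtain rfl : inst = instDecidableEqFin k := Subsingleton.elim _ _
    have key : ∀ i, θ (Function.update (Function.update Y j (f • A)) i
          (lieBr X (Function.update Y j (f • A) i))) =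
        f • θ (Function.update (Function.update Y j A) i (lieBr X (Function.update Y j A i))) +
        if i = j then dirDeriv X f • θ (Function.update Y j A) else 0 := by
      intro i
      by_cases h : i = j
      · subst h; simp [lieBr_smul_right]
      · simp only [Function.update_of_ne h, if_neg h]
        rw [Function.update_comm (Ne.symm h), Function.update_comm (Ne.symm h),
          θ.map_update_smul, add_zero]
    simp only [key, Finset.sum_add_distrib, θ.map_update_smul, smul_eq_mul, dirDeriv_mul,
      Finset.sum_ite_eq', Finset.mem_univ, if_true, ← Finset.mul_sum]
    ring
  map_eq_zero_of_eq' := by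
    intro Y a b hab hne
    rw [θ.map_eq_zero_of_eq Y hab hne, dirDeriv_zero, zero_sub, neg_eq_zero,
      Finset.sum_eq_add a b hne]
    · have h : Function.update Y b (lieBr X (Y b)) =
          Function.update Y a (lieBr X (Y a)) ∘ Equiv.swap a b := by
        ext i : 1
        by_cases hia : i = a
        · subst hia; simp [hne, hab, Ne.symm hne]
        · by_cases hib : i = b
          · subst hib; simp [hab]
          · simp [Equiv.swap_apply_of_ne_of_ne hia hib, hia, hib]
      rw [h, θ.map_swap _ hne, add_neg_cancel]
    · intro c _ hc
      refine θ.map_eq_zero_of_eq _ ?_ hne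
      rw [Function.update_of_ne hc.1.symm, Function.update_of_ne hc.2.symm, hab]
    · simp
    · simp

theorem lieDeriv_apply {k : ℕ} (X : VField n M) (θ : Form n M k) (Y : Fin k → VField n M) :
    lieDeriv X θ Y = dirDeriv X (θ Y) - ∑ i, θ (Function.update Y i (lieBr X (Y i))) := rfl

/-- The wedge product `α ∧ θ` of a `1`-form and a `k`-form:
`(α ∧ θ)(Y₀, …, Y_k) = ∑ i, (-1)^i α(Y_i) θ(Y₀, …, Ŷ_i, …, Y_k)`. -/
def wedge {k : ℕ} (α : OneForm n M) (θ : Form n M k) : Form n M (k + 1) :=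
  AlternatingMap.alternatizeUncurryFin (LinearMap.smulRight α θ)

theorem wedge_apply {k : ℕ} (α : OneForm n M) (θ : Form n M k) (Y : Fin (k + 1) → VField n M) :
    wedge α θ Y = ∑ i : Fin (k + 1), (-1) ^ (i : ℕ) * (α (Y i) * θ (i.removeNth Y)) := by
  simp only [wedge, AlternatingMap.alternatizeUncurryFin_apply, LinearMap.smulRight_apply,
    AlternatingMap.smul_apply, smul_eq_mul, zsmul_eq_mul]
  push_cast
  rfl

theorem lieDeriv_add {k : ℕ} (X : VField n M) (θ η : Form n M k) :
    lieDeriv X (θ + η) = lieDeriv X θ + lieDeriv X η := by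
  ext1 Y
  simp only [lieDeriv_apply, AlternatingMap.add_apply, dirDeriv_add, Finset.sum_add_distrib]
  ring

theorem lieDeriv_smul {k : ℕ} (X : VField n M) (f : SmoothFun n M) (θ : Form n M k) :
    lieDeriv X (f • θ) = f • lieDeriv X θ + dirDeriv X f • θ := by
  ext1 Y
  simp only [lieDeriv_apply, AlternatingMap.add_apply, AlternatingMap.smul_apply, smul_eq_mul,
    dirDeriv_mul, ← Finset.mul_sum]
  ring

theorem lieDeriv_add_left {k : ℕ} (X Y : VField n M) (θ : Form n M k) :
    lieDeriv (X + Y) θ = lieDeriv X θ + lieDeriv Y θ := by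
  ext1 Z
  simp only [lieDeriv_apply, AlternatingMap.add_apply, dirDeriv_add_left, lieBr_add_left,
    θ.map_update_add, Finset.sum_add_distrib]
  ring

theorem lieDeriv_smul_left_apply {k : ℕ} (f : SmoothFun n M) (X : VField n M) (θ : Form n M k)
    (Y : Fin k → VField n M) :
    lieDeriv (f • X) θ Y =
      f * lieDeriv X θ Y + ∑ i, dirDeriv (Y i) f * θ (Function.update Y i X) := by
  simp only [lieDeriv_apply, dirDeriv_smul_left, lieBr_smul_left, θ.map_update_sub,
    θ.map_update_smul, smul_eq_mul, Finset.sum_sub_distrib, ← Finset.mul_sum]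
  ring

theorem lieDeriv_smul_left {k : ℕ} (f : SmoothFun n M) (X : VField n M) (θ : Form n M (k + 1)) :
    lieDeriv (f • X) θ = f • lieDeriv X θ + wedge (dFun f) (θ.curryLeft X) := by
  ext1 Y
  rw [lieDeriv_smul_left_apply, AlternatingMap.add_apply, AlternatingMap.smul_apply, smul_eq_mul,
    wedge_apply]
  congr 1
  refine Finset.sum_congr rfl fun i _ => ?_
  have h := θ.map_insertNth i X (i.removeNth Y)
  rw [Fin.insertNth_removeNth] at h
  rw [h, AlternatingMap.curryLeft_apply_apply, zsmul_eq_mul]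
  push_cast
  simp only [dFun, LinearMap.coe_mk, AddHom.coe_mk, Matrix.vecCons]
  ring

theorem curryLeft_wedge {k : ℕ} (α : OneForm n M) (θ : Form n M (k + 1)) (X : VField n M) :
    (wedge α θ).curryLeft X = α X • θ - wedge α (θ.curryLeft X) := by
  ext1 Y
  rw [AlternatingMap.curryLeft_apply_apply, wedge_apply, Fin.sum_univ_succ,
    AlternatingMap.sub_apply, wedge_apply, sub_eq_add_neg, ← Finset.sum_neg_distrib]
  congr 1
  · simp [Matrix.vecCons]
  · refine Finset.sum_congr rfl fun i _ => ?_
    have : (i.succ.removeNth (Matrix.vecCons X Y) : Fin (k + 1) → VField n M) =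
        Matrix.vecCons X (i.removeNth Y) := by
      ext j : 1
      induction j using Fin.cases with
      | zero => rfl
      | succ j => simp [Matrix.vecCons, Fin.removeNth]
    rw [this, AlternatingMap.curryLeft_apply_apply]
    simp [pow_succ]

theorem curryLeft_wedge_zero (α : OneForm n M) (θ : Form n M 0) (X : VField n M) :
    (wedge α θ).curryLeft X = α X • θ := by
  ext1 Y
  rw [AlternatingMap.curryLeft_apply_apply, wedge_apply, Fin.sum_univ_succ]
  simp [Subsingleton.elim _ Y]

theorem curryLeft_lieDeriv {k : ℕ} (X Y : VField n M) (θ : Form n M (k + 1)) :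
    (lieDeriv X θ).curryLeft Y = lieDeriv X (θ.curryLeft Y) - θ.curryLeft (lieBr X Y) := by
  ext1 Z
  rw [AlternatingMap.curryLeft_apply_apply, lieDeriv_apply, Fin.sum_univ_succ,
    AlternatingMap.sub_apply, lieDeriv_apply]
  simp only [AlternatingMap.curryLeft_apply_apply, Matrix.vecCons, Fin.cons_zero, Fin.cons_succ,
    Fin.update_cons_zero, Fin.cons_update]
  ring

/-- A `(k+1)`-form from a `C^∞(M)`-linear map `F` into `k`-forms such that `F X` vanishes as soon
as one of its arguments is `X`. -/
def uncurryForm {k : ℕ} (F : VField n M →ₗ[SmoothFun n M] Form n M k)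
    (hF : ∀ X (Y : Fin k → VField n M) i, Y i = X → F X Y = 0) : Form n M (k + 1) :=
  { LinearMap.uncurryLeft (M := fun _ => VField n M)
      ((AlternatingMap.toMultilinearMapLM (S := SmoothFun n M)).comp F) with
    map_eq_zero_of_eq' := by
      intro Y i j hij hne
      change F (Y 0) (Fin.tail Y) = 0
      induction i using Fin.cases with
      | zero =>
        induction j using Fin.cases with
        | zero => exact absurd rfl hne
        | succ j => exact hF _ _ j hij.symm
      | succ i =>
        induction j using Fin.cases with
        | zero => exact hF _ _ i hij
        | succ j => exact (F (Y 0)).map_eq_zero_of_eq _ hij (fun h => hne (by rw [h])) }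

theorem curryLeft_uncurryForm {k : ℕ} (F : VField n M →ₗ[SmoothFun n M] Form n M k) (hF)
    (X : VField n M) : (uncurryForm F hF).curryLeft X = F X := rfl

theorem form_ext {k : ℕ} {θ η : Form n M (k + 1)}
    (h : ∀ X, θ.curryLeft X = η.curryLeft X) : θ = η := by
  ext1 Y
  have := congrArg (fun ξ : Form n M k => ξ (Fin.tail Y)) (h (Y 0))
  simpa [Matrix.vecCons] using this

/-- The properties of the exterior derivative on `k`-forms that make the recursion for
`(k+1)`-forms well defined. -/
structure IsExtDeriv {k : ℕ} (D : Form n M k → Form n M (k + 1)) : Prop where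
  add : ∀ θ η, D (θ + η) = D θ + D η
  smul : ∀ (f : SmoothFun n M) θ, D (f • θ) = f • D θ + wedge (dFun f) θ
  curry : ∀ X θ, (∀ (Y : Fin k → VField n M) i, Y i = X → θ Y = 0) →
    (D θ).curryLeft X = lieDeriv X θ

theorem eq_zero_of_curryLeft {k : ℕ} (X : VField n M) (θ : Form n M (k + 1))
    (h : θ.curryLeft X = 0) (Y : Fin (k + 1) → VField n M) (i : Fin (k + 1)) (hi : Y i = X) :
    θ Y = 0 := by
  have e := θ.map_insertNth i X (i.removeNth Y)
  rw [← hi, Fin.insertNth_self_removeNth, hi] at e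
  have h2 : θ (Matrix.vecCons X (i.removeNth Y)) = 0 := by
    rw [← AlternatingMap.curryLeft_apply_apply, h]; rfl
  rw [e]
  exact (congrArg _ h2).trans (smul_zero _)

/-- The exterior derivative on functions: `(d f)(X) = X(f)`. -/
def extDerivZero (θ : Form n M 0) : Form n M 1 :=
  uncurryForm
    { toFun := fun X => lieDeriv X θ
      map_add' := fun X Y => lieDeriv_add_left X Y θ
      map_smul' := fun f X => by
        ext1 Y
        rw [lieDeriv_smul_left_apply]
        simp }
    (fun _ _ i => i.elim0)

theorem isExtDeriv_zero : IsExtDeriv (extDerivZero (n := n) (M := M)) where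
  add θ η := by
    refine form_ext fun X => ?_
    rw [AlternatingMap.curryLeft_add, LinearMap.add_apply]
    exact lieDeriv_add X θ η
  smul f θ := by
    refine form_ext fun X => ?_
    rw [AlternatingMap.curryLeft_add, LinearMap.add_apply, curryLeft_wedge_zero]
    exact lieDeriv_smul X f θ
  curry X θ _ := rfl

/-- The exterior derivative on `(k+1)`-forms in terms of that on `k`-forms, through Cartan's
formula `ι_X (d θ) = L_X θ - d (ι_X θ)`. -/
def extDerivSucc {k : ℕ} (D : {D : Form n M k → Form n M (k + 1) // IsExtDeriv D})
    (θ : Form n M (k + 1)) : Form n M (k + 2) :=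
  uncurryForm
    { toFun := fun X => lieDeriv X θ - D.1 (θ.curryLeft X)
      map_add' := fun X Y => by
        rw [lieDeriv_add_left, map_add, D.2.add]; abel
      map_smul' := fun f X => by
        rw [lieDeriv_smul_left, map_smul, D.2.smul, RingHom.id_apply, smul_sub]; abel }
    (fun X Y i hi => by
      refine eq_zero_of_curryLeft X _ ?_ Y i hi
      change (lieDeriv X θ - D.1 (θ.curryLeft X)).curryLeft X = 0
      have h1 : (D.1 (θ.curryLeft X)).curryLeft X = lieDeriv X (θ.curryLeft X) := by
        refine D.2.curry X _ fun Z j hj => ?_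
        rw [AlternatingMap.curryLeft_apply_apply]
        refine θ.map_eq_zero_of_eq _ (i := 0) (j := j.succ) ?_ (Fin.succ_ne_zero j).symm
        simp [hj]
      have h2 := curryLeft_lieDeriv X X θ
      rw [lieBr_self, map_zero, sub_zero] at h2
      ext1 Z
      have h1' := congrArg (fun ξ : Form n M k => ξ Z) h1
      have h2' := congrArg (fun ξ : Form n M k => ξ Z) h2
      simp only [AlternatingMap.curryLeft_apply_apply] at h1' h2'
      rw [AlternatingMap.curryLeft_apply_apply, AlternatingMap.sub_apply, h1', h2', sub_self]
      rfl)

theorem isExtDeriv_succ {k : ℕ} (D : {D : Form n M k → Form n M (k + 1) // IsExtDeriv D}) :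
    IsExtDeriv (extDerivSucc D) where
  add θ η := by
    refine form_ext fun X => ?_
    rw [AlternatingMap.curryLeft_add, LinearMap.add_apply]
    change lieDeriv X (θ + η) - D.1 ((θ + η).curryLeft X) =
      (lieDeriv X θ - D.1 (θ.curryLeft X)) + (lieDeriv X η - D.1 (η.curryLeft X))
    rw [lieDeriv_add, AlternatingMap.curryLeft_add, LinearMap.add_apply, D.2.add]; abel
  smul f θ := by
    refine form_ext fun X => ?_
    rw [AlternatingMap.curryLeft_add, LinearMap.add_apply, curryLeft_wedge]
    change lieDeriv X (f • θ) - D.1 ((f • θ).curryLeft X) =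
      f • (lieDeriv X θ - D.1 (θ.curryLeft X)) + (dirDeriv X f • θ - _)
    rw [lieDeriv_smul, AlternatingMap.curryLeft_smul, LinearMap.smul_apply, D.2.smul, smul_sub]
    abel
  curry X θ h := by
    change lieDeriv X θ - D.1 (θ.curryLeft X) = _
    have h0 : θ.curryLeft X = 0 := by
      ext1 Y
      exact h _ 0 rfl
    have hD : D.1 0 = 0 := by simpa using D.2.add 0 0
    rw [h0, hD, sub_zero]

/-- The recursive construction of the exterior derivative. -/
def extDerivAux : (k : ℕ) → {D : Form n M k → Form n M (k + 1) // IsExtDeriv D}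
  | 0 => ⟨extDerivZero, isExtDeriv_zero⟩
  | k + 1 => ⟨extDerivSucc (extDerivAux k), isExtDeriv_succ (extDerivAux k)⟩

/-- The exterior derivative `d : Ω^k(M) → Ω^{k+1}(M)`, determined by `(d f)(X) = X(f)` on functions
and by Cartan's formula `ι_X d + d ι_X = L_X`. -/
def extD {k : ℕ} (θ : Form n M k) : Form n M (k + 1) := (extDerivAux k).1 θ

end

end GenGeom

end

noncomputable section

namespace GenGeom

/-- Smooth sections `X + α` of the generalized tangent bundle `𝕋M = TM ⊕ T*M`. -/
abbrev GenSec (n : ℕ) (M : Type*) [TopologicalSpace M]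
    [ChartedSpace (EuclideanSpace ℝ (Fin n)) M] [IsManifold (𝓡 n) ∞ M] : Type _ :=
  VField n M × OneForm n M

/-- Smooth bundle endomorphisms of `𝕋M`, as `C^∞(M)`-linear endomorphisms of its sections. -/
abbrev GenEnd (n : ℕ) (M : Type*) [TopologicalSpace M]
    [ChartedSpace (EuclideanSpace ℝ (Fin n)) M] [IsManifold (𝓡 n) ∞ M] : Type _ :=
  Module.End (SmoothFun n M) (GenSec n M)

/-- The space `Ω(M)` of differential forms. As `Ω^k(M) = 0` for `k > n`, the product
over all `k` is the direct sum of the `Ω^k(M)` with `0 ≤ k ≤ n`. -/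
def TotalForm (n : ℕ) (M : Type*) [TopologicalSpace M]
    [ChartedSpace (EuclideanSpace ℝ (Fin n)) M] [IsManifold (𝓡 n) ∞ M] : Type _ :=
  (k : ℕ) → Form n M k

instance (n : ℕ) (M : Type*) [TopologicalSpace M]
    [ChartedSpace (EuclideanSpace ℝ (Fin n)) M] [IsManifold (𝓡 n) ∞ M] :
    AddCommGroup (TotalForm n M) :=
  inferInstanceAs (AddCommGroup ((k : ℕ) → Form n M k))

instance (n : ℕ) (M : Type*) [TopologicalSpace M]
    [ChartedSpace (EuclideanSpace ℝ (Fin n)) M] [IsManifold (𝓡 n) ∞ M] :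
    Module ℝ (TotalForm n M) :=
  inferInstanceAs (Module ℝ ((k : ℕ) → Form n M k))

/-- `ℝ`-linear operators on differential forms. -/
abbrev FormOp (n : ℕ) (M : Type*) [TopologicalSpace M]
    [ChartedSpace (EuclideanSpace ℝ (Fin n)) M] [IsManifold (𝓡 n) ∞ M] : Type _ :=
  Module.End ℝ (TotalForm n M)

section

variable {n : ℕ} {M : Type*} [TopologicalSpace M]
  [ChartedSpace (EuclideanSpace ℝ (Fin n)) M] [IsManifold (𝓡 n) ∞ M]

theorem extD_add {k : ℕ} (θ η : Form n M k) : extD (θ + η) = extD θ + extD η :=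
  (extDerivAux k).2.add θ η

theorem extD_const_smul {k : ℕ} (c : ℝ) (θ : Form n M k) : extD (c • θ) = c • extD θ := by
  have h : ∀ {j : ℕ} (η : Form n M j), c • η = algebraMap ℝ (SmoothFun n M) c • η := by
    intro j η
    ext1 Y
    exact Algebra.smul_def c (η Y)
  have h0 : dFun (algebraMap ℝ (SmoothFun n M) c) = 0 := by
    ext1 X
    exact dirDeriv_algebraMap X c
  rw [h, h]
  refine ((extDerivAux k).2.smul _ θ).trans ?_
  rw [h0]
  have h1 : wedge (0 : OneForm n M) θ = 0 := by
    ext1 Y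
    simp [wedge_apply]
  rw [h1, add_zero]
  rfl

/-- The de Rham differential as an operator on forms. -/
def deRham : FormOp n M where
  toFun θ
    | 0 => 0
    | k + 1 => extD (θ k)
  map_add' θ η := by
    funext k
    cases k with
    | zero => exact (add_zero _).symm
    | succ k => exact extD_add _ _
  map_smul' c θ := by
    funext k
    cases k with
    | zero => exact (smul_zero c).symm
    | succ k => exact extD_const_smul _ _

/-- Multiplication by a function, as an operator on forms. -/
def mulOp (f : SmoothFun n M) : FormOp n M where
  toFun θ k := f • θ k
  map_add' θ η := by funext k; exact smul_add _ _ _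
  map_smul' c θ := by funext k; exact smul_comm f c (θ k)

/-- The interior product with a vector field, as an operator on forms. -/
def iotaOp (X : VField n M) : FormOp n M where
  toFun θ k := (θ (k + 1)).curryLeft X
  map_add' θ η := by funext k; rfl
  map_smul' c θ := by funext k; rfl

/-- Left multiplication by a `1`-form, as an operator on forms. -/
def wedgeOp (α : OneForm n M) : FormOp n M where
  toFun θ
    | 0 => 0
    | k + 1 => wedge α (θ k)
  map_add' θ η := by
    funext k
    cases k with
    | zero => exact (add_zero _).symm
    | succ k =>
      change wedge α (θ k + η k) = wedge α (θ k) + wedge α (η k)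
      ext1 Y
      simp only [wedge_apply, AlternatingMap.add_apply, mul_add, Finset.sum_add_distrib]
  map_smul' c θ := by
    funext k
    cases k with
    | zero => exact (smul_zero c).symm
    | succ k =>
      change wedge α (c • θ k) = c • wedge α (θ k)
      ext1 Y
      simp only [wedge_apply, AlternatingMap.smul_apply, mul_smul_comm, Finset.smul_sum]

/-- The action of a section `X + α` of `𝕋M` on forms: `θ ↦ ι_X θ + α ∧ θ`. It is odd. -/
def secOp (x : GenSec n M) : FormOp n M := iotaOp x.1 + wedgeOp x.2

/-- The constant function `1` as a form. -/
def unitForm : TotalForm n M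
  | 0 => AlternatingMap.constOfIsEmpty (SmoothFun n M) (VField n M) (Fin 0) 1
  | _ + 1 => 0

/-- The graded commutator `[A, B] = A B - (-1)^{a b} B A` of operators of degrees `a`, `b`
(only their parities matter). -/
def gradedComm (a b : ℕ) (A B : FormOp n M) : FormOp n M :=
  A * B - (-1 : ℝ) ^ (a * b) • (B * A)

/-- The derived bracket `⟦x, y⟧_δ = [[x, δ], y]` of sections of `𝕋M` with respect to an odd
operator `δ`. -/
def derivedBracket (δ : FormOp n M) (x y : GenSec n M) : FormOp n M :=
  gradedComm 0 1 (gradedComm 1 1 (secOp x) δ) (secOp y)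

/-- The tautological inner product `⟨X + α, Y + β⟩ = (α(Y) + β(X)) / 2`. -/
def tautInner (x y : GenSec n M) : SmoothFun n M :=
  (1 / 2 : ℝ) • (x.2 y.1 + y.2 x.1)

/-- Skew-symmetry with respect to the tautological inner product. -/
def IsSkew (φ : GenEnd n M) : Prop :=
  ∀ x y, tautInner (φ x) y + tautInner x (φ y) = 0

/-- The Lie derivative of a `1`-form: `(L_X β)(Z) = X(β(Z)) - β([X, Z])`. -/
def lieOneForm (X : VField n M) (β : OneForm n M) : OneForm n M where
  toFun Z := dirDeriv X (β Z) - β (lieBr X Z)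
  map_add' Y Z := by rw [map_add, dirDeriv_add, lieBr_add_right, map_add]; ring
  map_smul' f Z := by
    rw [map_smul, smul_eq_mul, dirDeriv_mul, lieBr_smul_right, map_add, map_smul, map_smul,
      RingHom.id_apply]
    simp only [smul_eq_mul]
    ring

/-- The interior product of `dα` with a vector field:
`ι_Y dα = L_Y α - d(α(Y))`. -/
def iotaD (Y : VField n M) (α : OneForm n M) : OneForm n M :=
  lieOneForm Y α - dFun (α Y)

/-- The Dorfman bracket `⟦X + α, Y + β⟧ = [X, Y] + L_X β - ι_Y dα`. -/
def dorfman (x y : GenSec n M) : GenSec n M :=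
  (lieBr x.1 y.1, lieOneForm x.1 y.2 - iotaD y.1 x.2)

/-- The Courant-Nijenhuis torsion of an endomorphism of `𝕋M`. -/
def courantNijenhuis (φ : GenEnd n M) (x y : GenSec n M) : GenSec n M :=
  φ (φ (dorfman x y)) + dorfman (φ x) (φ y) - φ (dorfman (φ x) y + dorfman x (φ y))

/-- A generalized Nijenhuis operator: the Courant-Nijenhuis torsion vanishes. -/
def IsGenNijenhuis (φ : GenEnd n M) : Prop :=
  ∀ x y, courantNijenhuis φ x y = 0

/-- The ideal of functions vanishing at `p`. -/
def vanishingIdeal (n : ℕ) {M : Type*} [TopologicalSpace M]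
    [ChartedSpace (EuclideanSpace ℝ (Fin n)) M] (p : M) : Ideal (SmoothFun n M) :=
  RingHom.ker (ContMDiffMap.evalRingHom p : SmoothFun n M →+* ℝ)

/-- The fibre `𝕋_pM = T_pM ⊕ T_p*M`, as the sections of `𝕋M` modulo the linear combinations of
sections with coefficients vanishing at `p` (these are exactly the sections that vanish at `p`). -/
def Fibre (n : ℕ) {M : Type*} [TopologicalSpace M]
    [ChartedSpace (EuclideanSpace ℝ (Fin n)) M] [IsManifold (𝓡 n) ∞ M] (p : M) : Type _ :=
  GenSec n M ⧸ (vanishingIdeal n p • (⊤ : Submodule (SmoothFun n M) (GenSec n M)))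

instance (p : M) : AddCommGroup (Fibre n p) :=
  inferInstanceAs (AddCommGroup
    (GenSec n M ⧸ (vanishingIdeal n p • (⊤ : Submodule (SmoothFun n M) (GenSec n M)))))

instance (p : M) : Module ℝ (Fibre n p) :=
  inferInstanceAs (Module ℝ
    (GenSec n M ⧸ (vanishingIdeal n p • (⊤ : Submodule (SmoothFun n M) (GenSec n M)))))

/-- The endomorphism `φ_p` of the fibre `𝕋_pM` induced by an endomorphism `φ` of `𝕋M`. -/
def fibreMap (φ : GenEnd n M) (p : M) : Module.End ℝ (Fibre n p) :=
  let N : Submodule (SmoothFun n M) (GenSec n M) := vanishingIdeal n p • ⊤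
  let ψ : (GenSec n M ⧸ N) →ₗ[ℝ] (GenSec n M ⧸ N) :=
    (Submodule.mapQ N N φ (by
      rw [← Submodule.map_le_iff_le_comap, Submodule.map_smul'']
      exact Submodule.smul_mono le_rfl le_top)).restrictScalars ℝ
  ψ

/-- `φ` is a generalized polynomial structure with minimal polynomial `P`: it is skew-symmetric
and the monic polynomial `P`, of positive degree, is the minimal polynomial of `φ_p` for all `p`. -/
structure IsGenPolyStructure (φ : GenEnd n M) (P : ℝ[X]) : Prop where
  skew : IsSkew φ
  monic : P.Monic
  degree_pos : 0 < P.natDegree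
  minpoly_eq : ∀ p : M, minpoly ℝ (fibreMap φ p) = P

/-- The set of all (complex) eigenvalues of the endomorphisms `φ_p`. -/
def eigenvalueSet (φ : GenEnd n M) : Set ℂ :=
  {z | ∃ p : M, Module.End.HasEigenvalue ((fibreMap φ p).baseChange ℂ) z}

/-- `s` and `ν` are the semisimple and the nilpotent part of `φ`: fibrewise, `φ = s + ν` is the
Jordan-Chevalley decomposition. -/
structure IsJordanChevalley (φ s ν : GenEnd n M) : Prop where
  add_eq : s + ν = φ
  commute : Commute s ν
  semisimple : ∀ p : M, (fibreMap s p).IsSemisimple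
  nilpotent : ∀ p : M, IsNilpotent (fibreMap ν p)

/-- `Φ` is the lift of a skew-symmetric endomorphism `φ` to operators on forms: the even
operator with `[Φ, f] = 0` for functions `f`, `[Φ, x] = φ(x)` for sections `x` of `𝕋M`, and
`Φ(1) ∈ Ω²(M)`. -/
structure IsLift (φ : GenEnd n M) (Φ : FormOp n M) : Prop where
  even_even : ∀ θ, (∀ k, Odd k → θ k = 0) → ∀ k, Odd k → Φ θ k = 0
  even_odd : ∀ θ, (∀ k, Even k → θ k = 0) → ∀ k, Even k → Φ θ k = 0
  comm_fun : ∀ f : SmoothFun n M, gradedComm 0 0 Φ (mulOp f) = 0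
  comm_sec : ∀ x : GenSec n M, gradedComm 0 1 Φ (secOp x) = secOp (φ x)
  apply_one : ∀ k, k ≠ 2 → Φ unitForm k = 0

/-- The adjoint action `A ↦ [Φ, A] = Φ A - A Φ` of an even operator `Φ`. -/
def adOp (Φ : FormOp n M) : Module.End ℝ (FormOp n M) where
  toFun A := Φ * A - A * Φ
  map_add' A B := by rw [mul_add, add_mul]; abel
  map_smul' c A := by rw [mul_smul_comm, smul_mul_assoc, RingHom.id_apply, smul_sub]

/-- The operator `P(ad_Φ)(d)` for an even operator `Φ`. -/
def minimalOperator (Φ : FormOp n M) (P : ℝ[X]) : FormOp n M :=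
  Polynomial.aeval (adOp Φ) P deRham

/-- `φ` is a minimal generalized polynomial structure with minimal polynomial `P`: its minimal
torsion, the derived bracket of `P(ad_Φ)(d)` with `Φ` the (unique) lift of `φ`, vanishes. -/
def IsMinimal (φ : GenEnd n M) (P : ℝ[X]) : Prop :=
  IsGenPolyStructure φ P ∧
    ∃ Φ : FormOp n M, IsLift φ Φ ∧ ∀ x y, derivedBracket (minimalOperator Φ P) x y = 0

/-- A generalized complex structure: a skew-symmetric `J` with `J² = -1` and vanishing
Courant-Nijenhuis torsion. -/
structure IsGenComplex (J : GenEnd n M) : Prop where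
  skew : IsSkew J
  sq : J * J = -1
  nijenhuis : IsGenNijenhuis J

/-- A weak generalized tangent structure: a skew-symmetric `J`, with minimal polynomial `x²` on
every fibre (`Im J_p ⊆ Ker J_p` may be a strict inclusion), and vanishing Courant-Nijenhuis
torsion. -/
structure IsWeakGenTangent (J : GenEnd n M) : Prop where
  polyStructure : IsGenPolyStructure J (Polynomial.X ^ 2)
  nijenhuis : IsGenNijenhuis J

end

end GenGeom

end

/-!
The proof separates the geometry, which is formal, from an identity for commuting operators.

*Skew-symmetry and the polynomial.* The pairing on sections of `𝕋M` is nondegenerate, since near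
every point there is a frame of vector fields with its dual frame of one-forms, cut off to global
objects (`exists_dualFrame`). The adjoint of a skew-symmetric `φ` is `-φ`, so a minimal polynomial of
degree four is an even function; if it has exactly two complex roots it equals `(X² - c)²` with
`c ≠ 0` (`IsGenPolyStructure.exists_eq_sq`). As `φ` itself is annihilated by this polynomial, and not
only its restrictions to the fibres, the Jordan–Chevalley parts are the global expressions
`s = (3 c φ - φ³) / 2c` and `ν = (φ³ - c φ) / 2c`; they satisfy `s² = c` and `ν² = 0`. Their
uniqueness is the uniqueness of the Jordan–Chevalley decomposition on the finite-dimensional fibres.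

*From operators to brackets.* The Dorfman bracket is the derived bracket of the de Rham differential
(`derivedBracket_deRham`), and for a lift `Φ` of `φ` the operator `[Φ, ·]` is a derivation of derived
brackets (`derivedBracket_adOp`). Hence the derived bracket of `P(ad_Φ)(d)` is the operation
`P(A)(⟦·, ·⟧)`, where `A` sends a bilinear operation `B` to `φ B(·, ·) - B(φ ·, ·) - B(·, φ ·)`
(`derivedBracket_aeval_adOp`). The lift exists (`exists_isLift`): the three blocks of `φ` are an
endomorphism of `TM`, a `2`-form and a bivector, which act by a derivation, by wedge multiplication
and by contraction. The contraction is computed in local dual frames, on whose choice it does not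
depend.

*The identity.* Write `A = σ + τ` with the contributions `σ` of `s` and `τ` of `ν`. These commute, and
`σ² - c = 2 T_s`, `τ² = 2 T_ν`, where `T_ψ` takes a bilinear operation to its Nijenhuis torsion with
respect to `ψ`. Moreover `u = σ² - c` satisfies `u (u - 8 c) = 0`, because the eigenvalues of `σ` are
`±√c` and `±3√c`, and `τ` is nilpotent. Therefore `P(A) = (u + 2 σ τ + τ²)²` is invertible on the image
of `u`, while on the kernel of `u` it is `τ²` times an invertible operator. So `P(A)(B) = 0` exactly
when both torsions of `B` vanish (`aeval_bilinAd_eq_zero_iff`). This gives the first statement, and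
for `c = -1` it shows that `φ ↦ (s, ν)` and `(J₁, J₂) ↦ J₁ + J₂` are inverse to each other; the condition
on the minimal polynomials matches fibrewise because `(J₁ + J₂)² + 1 = 2 J₁ J₂`
(`minpoly_add_eq_iff`).
-/

namespace GenGeom

/-! ### Commuting operators with two eigenvalues -/

section CommutingOperators

theorem isUnit_smul_eq_zero {R W : Type*} [CommRing R] [AddCommGroup W] [Module R W] {a b : R}
    {v : W} (hb : IsUnit b) (h : (b * a) • v = 0) : a • v = 0 := by
  obtain ⟨b, rfl⟩ := hb
  have := congrArg (fun v => (↑b⁻¹ : R) • v) h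
  simpa [smul_smul] using this

/-- The algebraic heart of the comparison of torsions. The elements `l, a, b` (with square `k`) and
`l', a', b'` (with square zero) stand for the composition of a bilinear map with the semisimple and
the nilpotent part in the target and in the two arguments. Put `σ = l - a - b`, `τ = l' - a' - b'`
and `u = σ² - k`; then `u` is twice the first torsion, `τ²` twice the second one, and
`u (u - 8 k) = 0`. -/
theorem smul_eq_zero_iff_torsions {𝕜 R W : Type*} [Field 𝕜] [CharZero 𝕜] [CommRing R] [Algebra 𝕜 R] [AddCommGroup W]
    [Module R W] {k l a b l' a' b' : R} (hk : IsUnit k)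
    (hl : l ^ 2 = k) (ha : a ^ 2 = k) (hb : b ^ 2 = k)
    (hl' : l' ^ 2 = 0) (ha' : a' ^ 2 = 0) (hb' : b' ^ 2 = 0) (v : W) :
    ((((l + l') - (a + a') - (b + b')) ^ 2 - k) ^ 2) • v = 0 ↔
      (l ^ 2 + a * b - l * (a + b)) • v = 0 ∧ (l' ^ 2 + a' * b' - l' * (a' + b')) • v = 0 := by
  have hnum : ∀ r : 𝕜, r ≠ 0 → IsUnit (algebraMap 𝕜 R r) := fun r hr => (IsUnit.mk0 r hr).map _
  have h2 : IsUnit (2 : R) := by simpa only [map_ofNat] using hnum 2 (by norm_num)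
  set x := l - a - b with hx
  set y := l' - a' - b' with hy
  have hu2 : x ^ 2 - k = 2 * (l ^ 2 + a * b - l * (a + b)) := by
    rw [hx]; linear_combination hb + ha - hl
  have hy2 : y ^ 2 = 2 * (l' ^ 2 + a' * b' - l' * (a' + b')) := by
    rw [hy]; linear_combination hb' + ha' - hl'
  set u := x ^ 2 - k with hu
  have huu : u * (u - 8 * k) = 0 := by
    have e : u = 2 * (l - a) * (l - b) := by rw [hu2]; ring
    have e1 : (l - a) ^ 2 = 2 * l * (l - a) := by linear_combination ha - hl
    have e2 : (l - b) ^ 2 = 2 * l * (l - b) := by linear_combination hb - hl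
    have : u ^ 2 = 16 * l ^ 2 * ((l - a) * (l - b)) := by
      rw [e]; linear_combination 4 * (l - b) ^ 2 * e1 + 8 * l * (l - a) * e2
    rw [mul_sub, ← sq, this, hl, e]; ring
  have hynil : IsNilpotent y :=
    (Commute.all _ _).isNilpotent_sub
      ((Commute.all _ _).isNilpotent_sub ⟨2, hl'⟩ ⟨2, ha'⟩) ⟨2, hb'⟩
  have hadd : ∀ {r s : R}, IsUnit r → IsUnit (r + y * s) := fun hr =>
    IsNilpotent.isUnit_add_left_of_commute ((Commute.all _ _).isNilpotent_mul_right hynil) hr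
      (Commute.all _ _)
  have h4 : IsUnit (4 * k) := by
    simpa only [map_ofNat] using (hnum 4 (by norm_num)).mul hk
  have h8 : IsUnit (8 * k) := by
    simpa only [map_ofNat] using (hnum 8 (by norm_num)).mul hk
  have expand : ((((l + l') - (a + a') - (b + b')) ^ 2 - k) ^ 2) =
      (4 * k + y * (4 * x + y)) * y ^ 2 + (u + 2 * (y * (2 * x + y)) + 4 * y ^ 2) * u := by
    rw [hu, hx, hy]; ring
  have key : ((((l + l') - (a + a') - (b + b')) ^ 2 - k) ^ 2) • v = 0 ↔
      u • v = 0 ∧ y ^ 2 • v = 0 := by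
    constructor
    · intro h
      have hu0 : u • v = 0 := by
        -- on the image of `u` one has `u = 8 k`, so that the operator is invertible there
        refine isUnit_smul_eq_zero ((hadd (s := 2 * x + y) h8).pow 2) ?_
        have := congrArg (fun v => u • v) h
        simp only [smul_smul, smul_zero] at this
        rw [← this]
        congr 1
        rw [expand, hu] at *
        linear_combination (-((x ^ 2 - k) + 8 * k + 2 * (y * (2 * x + y)))) * huu
      refine ⟨hu0, isUnit_smul_eq_zero (hadd (s := 4 * x + y) h4) ?_⟩
      rwa [expand, add_smul, mul_smul _ u, hu0, smul_zero, add_zero] at h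
    · rintro ⟨h1, h3⟩
      rw [expand, add_smul, mul_smul, mul_smul, h1, h3, smul_zero, smul_zero, add_zero]
  rw [key, hu2, hy2]
  constructor
  · rintro ⟨h1, h3⟩
    exact ⟨isUnit_smul_eq_zero h2 h1, isUnit_smul_eq_zero h2 h3⟩
  · rintro ⟨h1, h3⟩
    rw [mul_smul, mul_smul, h1, h3, smul_zero]
    exact ⟨rfl, rfl⟩

/-- A version of `smul_eq_zero_iff_torsions` for commuting elements of a noncommutative algebra. -/
theorem smul_eq_zero_iff_torsions_of_commute {𝕜 A W : Type*} [Field 𝕜] [CharZero 𝕜] [Ring A]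
    [Algebra 𝕜 A] [AddCommGroup W]
    [Module A W] {c : 𝕜} {l a b l' a' b' : A} (hc : c ≠ 0)
    (hcomm : ∀ x ∈ ({l, a, b, l', a', b'} : Set A), ∀ y ∈ ({l, a, b, l', a', b'} : Set A),
      x * y = y * x)
    (hl : l ^ 2 = algebraMap 𝕜 A c) (ha : a ^ 2 = algebraMap 𝕜 A c) (hb : b ^ 2 = algebraMap 𝕜 A c)
    (hl' : l' ^ 2 = 0) (ha' : a' ^ 2 = 0) (hb' : b' ^ 2 = 0) (v : W) :
    ((((l + l') - (a + a') - (b + b')) ^ 2 - algebraMap 𝕜 A c) ^ 2) • v = 0 ↔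
      (l ^ 2 + a * b - l * (a + b)) • v = 0 ∧ (l' ^ 2 + a' * b' - l' * (a' + b')) • v = 0 := by
  set T : Set A := {l, a, b, l', a', b'} with hT
  let _ : CommRing (Algebra.adjoin 𝕜 T) :=
    { Subalgebra.toRing (Algebra.adjoin 𝕜 T) with
      mul_comm := (Algebra.isMulCommutative_adjoin 𝕜 hcomm).is_comm.comm }
  have hmem : ∀ {t}, t ∈ T → t ∈ Algebra.adjoin 𝕜 T := fun h => Algebra.subset_adjoin h
  exact smul_eq_zero_iff_torsions (𝕜 := 𝕜) (R := Algebra.adjoin 𝕜 T)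
    (k := algebraMap 𝕜 _ c) (l := ⟨l, hmem (by simp [T])⟩)
    (a := ⟨a, hmem (by simp [T])⟩) (b := ⟨b, hmem (by simp [T])⟩)
    (l' := ⟨l', hmem (by simp [T])⟩) (a' := ⟨a', hmem (by simp [T])⟩)
    (b' := ⟨b', hmem (by simp [T])⟩) ((IsUnit.mk0 c hc).map _)
    (Subtype.ext hl) (Subtype.ext ha) (Subtype.ext hb) (Subtype.ext hl') (Subtype.ext ha')
    (Subtype.ext hb') v

variable {V : Type*} [AddCommGroup V] [Module ℝ V]

/-- Composition of bilinear maps with an endomorphism of the target. -/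
noncomputable def postComp (f : Module.End ℝ V) : Module.End ℝ (V →ₗ[ℝ] V →ₗ[ℝ] V) where
  toFun B := B.compr₂ f
  map_add' B C := by ext; simp
  map_smul' c B := by ext; simp

/-- Composition of bilinear maps with an endomorphism in the first argument. -/
noncomputable def preCompFst (f : Module.End ℝ V) : Module.End ℝ (V →ₗ[ℝ] V →ₗ[ℝ] V) where
  toFun B := B ∘ₗ f
  map_add' B C := by ext; simp
  map_smul' c B := by ext; simp

/-- Composition of bilinear maps with an endomorphism in the second argument. -/
noncomputable def preCompSnd (f : Module.End ℝ V) : Module.End ℝ (V →ₗ[ℝ] V →ₗ[ℝ] V) where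
  toFun B := B.compl₂ f
  map_add' B C := by ext; simp
  map_smul' c B := by ext; simp

@[simp] theorem postComp_apply (f : Module.End ℝ V) (B : V →ₗ[ℝ] V →ₗ[ℝ] V) (x y : V) :
    postComp f B x y = f (B x y) := rfl

@[simp] theorem preCompFst_apply (f : Module.End ℝ V) (B : V →ₗ[ℝ] V →ₗ[ℝ] V) (x y : V) :
    preCompFst f B x y = B (f x) y := rfl

@[simp] theorem preCompSnd_apply (f : Module.End ℝ V) (B : V →ₗ[ℝ] V →ₗ[ℝ] V) (x y : V) :
    preCompSnd f B x y = B x (f y) := rfl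

/-- The operator `B ↦ f B(·, ·) - B(f ·, ·) - B(·, f ·)` on bilinear maps. -/
noncomputable def bilinAd (f : Module.End ℝ V) : Module.End ℝ (V →ₗ[ℝ] V →ₗ[ℝ] V) :=
  postComp f - preCompFst f - preCompSnd f

theorem bilinAd_apply (f : Module.End ℝ V) (B : V →ₗ[ℝ] V →ₗ[ℝ] V) (x y : V) :
    bilinAd f B x y = f (B x y) - B (f x) y - B x (f y) := rfl

/-- The Nijenhuis torsion of an endomorphism with respect to a bilinear map. -/
noncomputable def bilinTorsion (f : Module.End ℝ V) : Module.End ℝ (V →ₗ[ℝ] V →ₗ[ℝ] V) :=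
  postComp f ^ 2 + preCompFst f * preCompSnd f - postComp f * (preCompFst f + preCompSnd f)

/-- For commuting `s`, `ν` with `s² = c ≠ 0` and `ν² = 0`, the polynomial `(X² - c)²` of the operator
`bilinAd (s + ν)` annihilates a bilinear map exactly when the torsions of `s` and `ν` vanish. -/
theorem aeval_bilinAd_eq_zero_iff {s ν : Module.End ℝ V} {c : ℝ} (hc : c ≠ 0) (hcomm : Commute s ν)
    (hs : s * s = algebraMap ℝ _ c) (hν : ν * ν = 0) (B : V →ₗ[ℝ] V →ₗ[ℝ] V) :
    Polynomial.aeval (bilinAd (s + ν)) ((Polynomial.X ^ 2 - Polynomial.C c) ^ 2 : ℝ[X]) B = 0 ↔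
      bilinTorsion s B = 0 ∧ bilinTorsion ν B = 0 := by
  have hsν : ∀ v, s (ν v) = ν (s v) := fun v => LinearMap.congr_fun hcomm.eq v
  have hs2 : ∀ v, s (s v) = c • v := fun v => LinearMap.congr_fun hs v
  have hν2 : ∀ v, ν (ν v) = 0 := fun v => LinearMap.congr_fun hν v
  have h1 : postComp s ^ 2 = algebraMap ℝ _ c := by ext B x y; simp [pow_two, hs2]
  have h2 : preCompFst s ^ 2 = algebraMap ℝ _ c := by ext B x y; simp [pow_two, hs2]
  have h3 : preCompSnd s ^ 2 = algebraMap ℝ _ c := by ext B x y; simp [pow_two, hs2]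
  have h4 : postComp ν ^ 2 = 0 := by ext B x y; simp [pow_two, hν2]
  have h5 : preCompFst ν ^ 2 = 0 := by ext B x y; simp [pow_two, hν2]
  have h6 : preCompSnd ν ^ 2 = 0 := by ext B x y; simp [pow_two, hν2]
  have hcomm' : ∀ x ∈ ({postComp s, preCompFst s, preCompSnd s, postComp ν, preCompFst ν,
        preCompSnd ν} : Set (Module.End ℝ (V →ₗ[ℝ] V →ₗ[ℝ] V))),
      ∀ y ∈ ({postComp s, preCompFst s, preCompSnd s, postComp ν, preCompFst ν,
        preCompSnd ν} : Set (Module.End ℝ (V →ₗ[ℝ] V →ₗ[ℝ] V))), x * y = y * x := by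
    rintro a (rfl | rfl | rfl | rfl | rfl | rfl) b (rfl | rfl | rfl | rfl | rfl | rfl) <;>
    · ext B x y; simp [hsν]
  have := smul_eq_zero_iff_torsions_of_commute (𝕜 := ℝ)
    (A := Module.End ℝ (V →ₗ[ℝ] V →ₗ[ℝ] V)) hc hcomm' h1 h2 h3 h4 h5 h6 B
  have hadd : bilinAd (s + ν) = (postComp s + postComp ν) - (preCompFst s + preCompFst ν) -
      (preCompSnd s + preCompSnd ν) := by
    ext B x y; simp [bilinAd_apply]
  have e : Polynomial.aeval (bilinAd (s + ν)) ((Polynomial.X ^ 2 - Polynomial.C c) ^ 2 : ℝ[X]) =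
      ((((postComp s + postComp ν) - (preCompFst s + preCompFst ν) -
      (preCompSnd s + preCompSnd ν)) ^ 2 - algebraMap ℝ _ c) ^ 2) := by
    rw [← hadd]; simp
  rw [e]
  exact this

end CommutingOperators

/-! ### Local dual frames -/

section LocalFrames

variable {n : ℕ} {M : Type*} [TopologicalSpace M]
  [ChartedSpace (EuclideanSpace ℝ (Fin n)) M] [IsManifold (𝓡 n) ∞ M]

/-- Globally defined vector fields `e i` and one-forms `ε i` which, where the function `ρ` does not
vanish, form a frame together with a multiple of its dual frame. -/
structure DualFrame (n : ℕ) (M : Type*) [TopologicalSpace M]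
    [ChartedSpace (EuclideanSpace ℝ (Fin n)) M] [IsManifold (𝓡 n) ∞ M] where
  /-- The scaling function. -/
  ρ : SmoothFun n M
  /-- The vector fields of the frame. -/
  e : Fin n → VField n M
  /-- The one-forms of the dual frame. -/
  ε : Fin n → OneForm n M
  sum_smul : ∀ X : VField n M, ∑ i, ε i X • e i = ρ • X

theorem DualFrame.sum_smul_oneForm (F : DualFrame n M) (α : OneForm n M) :
    ∑ i, α (F.e i) • F.ε i = F.ρ • α := by
  ext1 X
  have := congrArg α (F.sum_smul X)
  simp only [map_sum, map_smul, smul_eq_mul] at this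
  simp only [LinearMap.sum_apply, LinearMap.smul_apply, smul_eq_mul, ← this]
  exact Finset.sum_congr rfl fun i _ => mul_comm _ _

theorem sum_vField_apply {ι : Type*} (s : Finset ι) (X : ι → VField n M) (p : M) :
    (∑ i ∈ s, X i) p = ∑ i ∈ s, X i p := by
  classical
  induction s using Finset.induction_on with
  | empty => rfl
  | insert a s ha ih =>
    rw [Finset.sum_insert ha, Finset.sum_insert ha, ← ih]
    rfl

theorem exists_dualFrame [T2Space M] (p : M) : ∃ F : DualFrame n M, F.ρ p ≠ 0 := by
  classical
  let t := trivializationAt (EuclideanSpace ℝ (Fin n)) (TangentSpace (𝓡 n) : M → Type _) p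
  let b := (EuclideanSpace.basisFun (Fin n) ℝ).toBasis
  have hp : p ∈ t.baseSet := FiberBundle.mem_baseSet_trivializationAt' p
  have hnhds : t.baseSet ∈ nhds p := t.open_baseSet.mem_nhds hp
  obtain ⟨χ, -, hχ⟩ := (SmoothBumpFunction.nhds_basis_tsupport (I := 𝓡 n) p).mem_iff.1 hnhds
  have hχs : ContMDiff (𝓡 n) 𝓘(ℝ, ℝ) ∞ χ := χ.contMDiff
  let c : Fin n → (x : M) → (TangentSpace (𝓡 n) x →ₗ[ℝ] ℝ) := t.localFrameCoeff (𝓡 n) b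
  let e : Fin n → VField n M := fun i =>
    ⟨(χ : M → ℝ) • t.localFrame b i, ContMDiffOn.smul_section_of_tsupport hχs.contMDiffOn t.open_baseSet hχ
      (t.contMDiffOn_localFrame_baseSet ∞ b i)⟩
  let ε : Fin n → OneForm n M := fun i =>
    { toFun := fun X => ⟨fun x => χ x • c i x (X x), by
        refine contMDiff_of_tsupport fun x hx => ?_
        have hx' : x ∈ t.baseSet := hχ (tsupport_smul_subset_left _ _ hx)
        exact (hχs x).smul (contMDiffAt_localFrameCoeff b hx'
          (X.contMDiff x) i)⟩
      map_add' := fun X Y => by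
        ext x
        change χ x • c i x (X x + Y x) = χ x • c i x (X x) + χ x • c i x (Y x)
        rw [map_add, smul_add]
      map_smul' := fun f X => by
        ext x
        change χ x • c i x (f x • X x) = f x * (χ x • c i x (X x))
        rw [map_smul, smul_eq_mul, smul_eq_mul, smul_eq_mul]; ring }
  refine ⟨⟨⟨fun x => χ x * χ x, hχs.mul hχs⟩, e, ε, fun X => ?_⟩, ?_⟩
  · ext1 x
    have h1 : (∑ i, ε i X • e i) x = ∑ i, (χ x * c i x (X x)) • (χ x • t.localFrame b i x) := by
      rw [sum_vField_apply]
      rfl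
    have h2 : ((show SmoothFun n M from ⟨fun x => χ x * χ x, hχs.mul hχs⟩) • X) x =
      (χ x * χ x) • X x := rfl
    rw [h1, h2]
    by_cases hx : x ∈ t.baseSet
    · have h3 : X x = ∑ i, c i x (X x) • t.localFrame b i x :=
        Bundle.Trivialization.eq_sum_localFrameCoeff_smul (I := 𝓡 n) (b := b) (s := fun x => X x) hx
      conv_rhs => rw [h3]
      rw [Finset.smul_sum]
      refine Finset.sum_congr rfl fun i _ => ?_
      rw [smul_smul, smul_smul]
      congr 1; ring
    · have h0 : χ x = 0 := image_eq_zero_of_notMem_tsupport fun h => hx (hχ h)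
      simp [h0]
  · change χ p * χ p ≠ 0
    simp

end LocalFrames

/-! ### Nondegeneracy of the pairing and the fibres of `𝕋M` -/

section Fibres

variable {n : ℕ} {M : Type*} [TopologicalSpace M]
  [ChartedSpace (EuclideanSpace ℝ (Fin n)) M] [IsManifold (𝓡 n) ∞ M]

theorem vField_eq_zero_of_forall_oneForm [T2Space M] {X : VField n M}
    (h : ∀ α : OneForm n M, α X = 0) : X = 0 := by
  ext1 p
  obtain ⟨F, hF⟩ := exists_dualFrame (n := n) p
  have h1 : F.ρ • X = 0 := by rw [← F.sum_smul]; simp [h]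
  have h2 : F.ρ p • X p = 0 := by rw [← smul_apply, h1]; rfl
  exact (smul_eq_zero.1 h2).resolve_left hF

theorem two_smul_tautInner (x y : GenSec n M) : (2 : ℝ) • tautInner x y = x.2 y.1 + y.2 x.1 := by
  rw [tautInner, smul_smul]; norm_num

theorem tautInner_comm (x y : GenSec n M) : tautInner x y = tautInner y x := by
  rw [tautInner, tautInner, add_comm]

theorem eq_zero_of_forall_tautInner [T2Space M] {x : GenSec n M}
    (h : ∀ y, tautInner x y = 0) : x = 0 := by
  have h' : ∀ y : GenSec n M, x.2 y.1 + y.2 x.1 = 0 := fun y => by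
    rw [← two_smul_tautInner, h, smul_zero]
  refine Prod.ext (vField_eq_zero_of_forall_oneForm fun α => ?_) ?_
  · simpa using h' (0, α)
  · ext1 Y
    simpa using h' (Y, 0)

theorem isSkew_iff (φ : GenEnd n M) :
    IsSkew φ ↔ ∀ x y : GenSec n M, tautInner (φ x) y = - tautInner x (φ y) :=
  forall₂_congr fun _ _ => eq_neg_iff_add_eq_zero.symm

theorem tautInner_add_right (x y z : GenSec n M) :
    tautInner x (y + z) = tautInner x y + tautInner x z := by
  simp only [tautInner, ← smul_add, Prod.fst_add, Prod.snd_add, map_add, LinearMap.add_apply]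
  congr 1; ring

theorem tautInner_smul_right (c : ℝ) (x y : GenSec n M) :
    tautInner x (c • y) = c • tautInner x y := by
  rw [tautInner, tautInner, smul_comm c, smul_add c]
  congr 2
  exact LinearMap.map_smul_of_tower x.2 c y.1

theorem tautInner_add_left (x y z : GenSec n M) :
    tautInner (x + y) z = tautInner x z + tautInner y z := by
  rw [tautInner_comm, tautInner_add_right, tautInner_comm z, tautInner_comm z]

theorem tautInner_smul_left (c : ℝ) (x y : GenSec n M) :
    tautInner (c • x) y = c • tautInner x y := by
  rw [tautInner_comm, tautInner_smul_right, tautInner_comm]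

theorem tautInner_neg_right (x y : GenSec n M) : tautInner x (-y) = -tautInner x y := by
  rw [eq_neg_iff_add_eq_zero, ← tautInner_add_right, neg_add_cancel]
  simpa using tautInner_smul_right 0 x 0

/-- The projection of sections of `𝕋M` onto the fibre at `p`, over the reals. -/
noncomputable def toFibre (p : M) : GenSec n M →ₗ[ℝ] Fibre n p where
  toFun x := Submodule.Quotient.mk x
  map_add' _ _ := rfl
  map_smul' _ _ := rfl

theorem toFibre_surjective (p : M) : Function.Surjective (toFibre (n := n) p) :=
  fun v => Submodule.Quotient.mk_surjective
    (vanishingIdeal n p • (⊤ : Submodule (SmoothFun n M) (GenSec n M))) v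

@[simp] theorem fibreMap_toFibre (φ : GenEnd n M) (p : M) (x : GenSec n M) :
    fibreMap φ p (toFibre p x) = toFibre p (φ x) := rfl

theorem toFibre_eq_zero_iff {p : M} {x : GenSec n M} : toFibre p x = 0 ↔
    x ∈ vanishingIdeal n p • (⊤ : Submodule (SmoothFun n M) (GenSec n M)) :=
  Submodule.Quotient.mk_eq_zero _

theorem toFibre_smul (p : M) (f : SmoothFun n M) (x : GenSec n M) :
    toFibre p (f • x) = f p • toFibre p x := by
  rw [← map_smul, ← sub_eq_zero, ← map_sub, toFibre_eq_zero_iff]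
  have h : f • x - f p • x = (f - algebraMap ℝ _ (f p)) • x := by
    refine Eq.trans ?_ (sub_smul f (algebraMap ℝ (SmoothFun n M) (f p)) x).symm
    rw [algebraMap_smul]
  rw [h]
  refine Submodule.smul_mem_smul ?_ trivial
  rw [vanishingIdeal, RingHom.mem_ker, map_sub]
  exact sub_self _

theorem eq_zero_of_forall_toFibre {x : GenSec n M} (h : ∀ p, toFibre p x = 0) : x = 0 := by
  have key : ∀ (p : M) (z : GenSec n M), toFibre p z = 0 →
      z.1 p = 0 ∧ ∀ Y, z.2 Y p = 0 := by
    intro p z hz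
    rw [toFibre_eq_zero_iff] at hz
    refine Submodule.smul_induction_on hz ?_ ?_
    · intro f hf z _
      have hf' : f p = 0 := hf
      refine ⟨?_, fun Y => ?_⟩
      · rw [Prod.smul_fst, smul_apply, hf', zero_smul]
      · change f p * z.2 Y p = 0
        rw [hf', zero_mul]
    · rintro y z ⟨h1, h2⟩ ⟨h3, h4⟩
      refine ⟨?_, fun Y => ?_⟩
      · change y.1 p + z.1 p = 0
        rw [h1, h3, add_zero]
      · change y.2 Y p + z.2 Y p = 0
        rw [h2, h4, add_zero]
  refine Prod.ext ?_ ?_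
  · ext1 p; exact (key p x (h p)).1
  · ext Y p; exact (key p x (h p)).2 Y

/-- Passing to the endomorphism of a fibre is an algebra homomorphism. -/
noncomputable def fibreMapHom (p : M) : GenEnd n M →ₐ[ℝ] Module.End ℝ (Fibre n p) :=
  AlgHom.ofLinearMap
    { toFun := fun φ => fibreMap φ p
      map_add' := fun φ ψ => by
        refine LinearMap.ext fun v => ?_
        obtain ⟨x, rfl⟩ := toFibre_surjective p v
        rfl
      map_smul' := fun c φ => by
        refine LinearMap.ext fun v => ?_
        obtain ⟨x, rfl⟩ := toFibre_surjective p v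
        rfl }
    (by
      refine LinearMap.ext fun v => ?_
      obtain ⟨x, rfl⟩ := toFibre_surjective p v
      rfl)
    (fun φ ψ => by
      refine LinearMap.ext fun v => ?_
      obtain ⟨x, rfl⟩ := toFibre_surjective p v
      rfl)

theorem fibreMapHom_apply (p : M) (φ : GenEnd n M) : fibreMapHom p φ = fibreMap φ p := rfl

theorem ext_fibreMap {φ ψ : GenEnd n M} (h : ∀ p, fibreMap φ p = fibreMap ψ p) : φ = ψ := by
  refine LinearMap.ext fun x => sub_eq_zero.1 (eq_zero_of_forall_toFibre fun p => ?_)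
  rw [map_sub, ← fibreMap_toFibre, ← fibreMap_toFibre, h, sub_self]

theorem DualFrame.sum_smul_genSec (F : DualFrame n M) (x : GenSec n M) :
    ∑ i, F.ε i x.1 • ((F.e i, 0) : GenSec n M) + ∑ i, x.2 (F.e i) • ((0, F.ε i) : GenSec n M) =
      F.ρ • x := by
  refine Prod.ext ?_ ?_
  · simp [Prod.fst_sum, F.sum_smul]
  · simp [Prod.snd_sum, F.sum_smul_oneForm]

instance finiteDimensional_fibre [T2Space M] (p : M) : FiniteDimensional ℝ (Fibre n p) := by
  obtain ⟨F, hF⟩ := exists_dualFrame (n := n) p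
  let g : Fin n ⊕ Fin n → Fibre n p :=
    Sum.elim (fun i => toFibre p (F.e i, 0)) (fun i => toFibre p (0, F.ε i))
  refine Module.Finite.of_fg_top ?_
  refine ⟨(Set.finite_range g).toFinset, ?_⟩
  rw [Set.Finite.coe_toFinset, eq_top_iff]
  rintro v -
  obtain ⟨x, rfl⟩ := toFibre_surjective p v
  have h := congrArg (toFibre p) (F.sum_smul_genSec x)
  rw [map_add, map_sum, map_sum, toFibre_smul] at h
  rw [← inv_smul_smul₀ (α := ℝ) hF (toFibre p x), ← h]
  refine Submodule.smul_mem _ _ (add_mem ?_ ?_) <;> refine Submodule.sum_mem _ fun i _ => ?_ <;>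
    rw [toFibre_smul] <;> refine Submodule.smul_mem _ _ (Submodule.subset_span ?_)
  exacts [⟨Sum.inl i, rfl⟩, ⟨Sum.inr i, rfl⟩]

end Fibres

/-! ### Cartan calculus for operators on forms -/

section Cartan

variable {n : ℕ} {M : Type*} [TopologicalSpace M]
  [ChartedSpace (EuclideanSpace ℝ (Fin n)) M] [IsManifold (𝓡 n) ∞ M]

theorem formOp_ext {A B : FormOp n M} (h : ∀ θ k, A θ k = B θ k) : A = B :=
  LinearMap.ext fun θ => funext fun k => h θ k

theorem iotaOp_apply (X : VField n M) (θ : TotalForm n M) (k : ℕ) :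
    iotaOp X θ k = (θ (k + 1)).curryLeft X := rfl

theorem wedgeOp_apply_succ (α : OneForm n M) (θ : TotalForm n M) (k : ℕ) :
    wedgeOp α θ (k + 1) = wedge α (θ k) := rfl

theorem totalForm_add_apply (θ η : TotalForm n M) (k : ℕ) : (θ + η) k = θ k + η k := rfl

theorem totalForm_zero_apply (k : ℕ) : (0 : TotalForm n M) k = 0 := rfl

/-- Rigidity of operators on forms: an operator that commutes or anticommutes with all interior
products and has no component in degree zero vanishes. -/
theorem formOp_eq_zero {Z : FormOp n M} (c : ℝ) (h0 : ∀ θ, Z θ 0 = 0)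
    (h : ∀ X, iotaOp X * Z = c • (Z * iotaOp X)) : Z = 0 := by
  refine formOp_ext fun θ k => ?_
  induction k generalizing θ with
  | zero => exact h0 θ
  | succ k ih =>
    refine form_ext fun X => ?_
    have h1 : iotaOp X (Z θ) k = c • Z (iotaOp X θ) k :=
      congrFun (LinearMap.congr_fun (h X) θ) k
    rw [iotaOp_apply, ih] at h1
    rw [h1, LinearMap.zero_apply, LinearMap.zero_apply, totalForm_zero_apply, smul_zero]
    rfl

/-- The Lie derivative as an operator on forms. -/
noncomputable def lieOp (X : VField n M) : FormOp n M where
  toFun θ k := lieDeriv X (θ k)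
  map_add' θ η := by funext k; exact lieDeriv_add _ _ _
  map_smul' c θ := by
    funext k
    refine AlternatingMap.ext fun Y => ?_
    change dirDeriv X (c • θ k Y) - ∑ i, c • _ = c • (dirDeriv X (θ k Y) - ∑ i, _)
    rw [dirDeriv_const_smul, smul_sub, Finset.smul_sum]
    rfl

theorem iotaOp_mul_iotaOp (X Y : VField n M) : iotaOp X * iotaOp Y = -(iotaOp Y * iotaOp X) := by
  refine formOp_ext fun θ k => ?_
  refine AlternatingMap.ext fun Z => ?_
  change θ (k + 2) (Matrix.vecCons Y (Matrix.vecCons X Z)) =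
    - θ (k + 2) (Matrix.vecCons X (Matrix.vecCons Y Z))
  rw [← AlternatingMap.map_swap _ _ (i := 0) (j := 1) (by simp)]
  congr 1
  ext i : 1
  refine Fin.cases ?_ (fun i => Fin.cases ?_ (fun i => ?_) i) i
  · simp
  · simp [Matrix.vecCons]
  · rw [Function.comp_apply, Equiv.swap_apply_of_ne_of_ne (Fin.succ_ne_zero _)
      (by simp [Fin.ext_iff])]
    rfl

theorem iotaOp_mul_wedgeOp (X : VField n M) (α : OneForm n M) :
    iotaOp X * wedgeOp α = mulOp (α X) - wedgeOp α * iotaOp X := by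
  refine formOp_ext fun θ k => ?_
  cases k with
  | zero =>
    refine (curryLeft_wedge_zero α (θ 0) X).trans ?_
    exact (sub_zero _).symm
  | succ k => exact curryLeft_wedge α (θ (k + 1)) X

theorem iotaOp_mul_deRham (X : VField n M) :
    iotaOp X * deRham = lieOp X - deRham * iotaOp X := by
  refine formOp_ext fun θ k => ?_
  cases k with
  | zero => exact (sub_zero _).symm
  | succ k => rfl

theorem iotaOp_mul_lieOp (X Y : VField n M) :
    iotaOp Y * lieOp X = lieOp X * iotaOp Y - iotaOp (lieBr X Y) :=
  formOp_ext fun θ k => curryLeft_lieDeriv X Y (θ (k + 1))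

theorem deRham_mul_mulOp (f : SmoothFun n M) :
    deRham * mulOp f = mulOp f * deRham + wedgeOp (dFun f) := by
  refine formOp_ext fun θ k => ?_
  cases k with
  | zero =>
    change (0 : Form n M 0) = f • (0 : Form n M 0) + 0
    rw [smul_zero, add_zero]
  | succ k => exact (extDerivAux k).2.smul f (θ k)

theorem lieOp_mul_mulOp (X : VField n M) (f : SmoothFun n M) :
    lieOp X * mulOp f = mulOp f * lieOp X + mulOp (dirDeriv X f) :=
  formOp_ext fun θ k => lieDeriv_smul X f (θ k)

theorem iotaOp_mul_mulOp (X : VField n M) (f : SmoothFun n M) :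
    iotaOp X * mulOp f = mulOp f * iotaOp X := rfl

theorem wedge_smul {k : ℕ} (α : OneForm n M) (f : SmoothFun n M) (θ : Form n M k) :
    wedge α (f • θ) = f • wedge α θ := by
  refine AlternatingMap.ext fun Y => ?_
  simp only [wedge_apply, AlternatingMap.smul_apply, smul_eq_mul, Finset.mul_sum]
  exact Finset.sum_congr rfl fun i _ => by ring

theorem wedgeOp_mul_mulOp (α : OneForm n M) (f : SmoothFun n M) :
    wedgeOp α * mulOp f = mulOp f * wedgeOp α := by
  refine formOp_ext fun θ k => ?_
  cases k with
  | zero => exact (smul_zero f).symm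
  | succ k => exact wedge_smul α f (θ k)

theorem mulOp_add (f g : SmoothFun n M) : mulOp (f + g) = mulOp f + mulOp g :=
  formOp_ext fun θ k => add_smul f g (θ k)

theorem mulOp_mul (f g : SmoothFun n M) : mulOp (f * g) = mulOp f * mulOp g :=
  formOp_ext fun θ k => mul_smul f g (θ k)

theorem iotaOp_add (X Y : VField n M) : iotaOp (X + Y) = iotaOp X + iotaOp Y :=
  formOp_ext fun θ k => map_add (θ (k + 1)).curryLeft X Y

theorem iotaOp_smul (f : SmoothFun n M) (X : VField n M) : iotaOp (f • X) = mulOp f * iotaOp X :=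
  formOp_ext fun θ k => map_smul (θ (k + 1)).curryLeft f X

theorem wedgeOp_add (α β : OneForm n M) : wedgeOp (α + β) = wedgeOp α + wedgeOp β := by
  refine formOp_ext fun θ k => ?_
  cases k with
  | zero => exact (add_zero _).symm
  | succ k =>
    refine AlternatingMap.ext fun Y => ?_
    change wedge (α + β) (θ k) Y = wedge α (θ k) Y + wedge β (θ k) Y
    simp only [wedge_apply, LinearMap.add_apply, add_mul, mul_add, Finset.sum_add_distrib]

theorem wedgeOp_smul (f : SmoothFun n M) (α : OneForm n M) :
    wedgeOp (f • α) = mulOp f * wedgeOp α := by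
  refine formOp_ext fun θ k => ?_
  cases k with
  | zero => exact (smul_zero f).symm
  | succ k =>
    refine AlternatingMap.ext fun Y => ?_
    change wedge (f • α) (θ k) Y = f * wedge α (θ k) Y
    simp only [wedge_apply, LinearMap.smul_apply, smul_eq_mul, Finset.mul_sum]
    exact Finset.sum_congr rfl fun i _ => by ring

theorem secOp_add (x y : GenSec n M) : secOp (x + y) = secOp x + secOp y := by
  rw [secOp, secOp, secOp, Prod.fst_add, Prod.snd_add, iotaOp_add, wedgeOp_add]; abel

theorem secOp_smul (f : SmoothFun n M) (x : GenSec n M) : secOp (f • x) = mulOp f * secOp x := by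
  rw [secOp, secOp, Prod.smul_fst, Prod.smul_snd, iotaOp_smul, wedgeOp_smul, mul_add]

theorem mulOp_algebraMap (c : ℝ) (A : FormOp n M) :
    mulOp (algebraMap ℝ (SmoothFun n M) c) * A = c • A :=
  formOp_ext fun θ k => AlternatingMap.ext fun Y => (Algebra.smul_def c (A θ k Y)).symm

/-- The assignment of operators to sections of `𝕋M` is linear over the reals. -/
noncomputable def secOpHom : GenSec n M →ₗ[ℝ] FormOp n M where
  toFun := secOp
  map_add' := secOp_add
  map_smul' c x := by
    rw [← algebraMap_smul (SmoothFun n M) c x, secOp_smul, mulOp_algebraMap]; rfl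

@[simp] theorem secOpHom_apply (x : GenSec n M) : secOpHom x = secOp x := rfl

theorem secOp_sub (x y : GenSec n M) : secOp (x - y) = secOp x - secOp y := secOpHom.map_sub x y

theorem wedgeOp_mul_wedgeOp (α β : OneForm n M) :
    wedgeOp α * wedgeOp β = -(wedgeOp β * wedgeOp α) := by
  rw [eq_neg_iff_add_eq_zero]
  refine formOp_eq_zero 1 (fun θ => ?_) fun X => ?_
  · exact add_zero _
  · have h1 := iotaOp_mul_wedgeOp X α
    have h2 := iotaOp_mul_wedgeOp X β
    have h3 := wedgeOp_mul_mulOp α (β X)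
    have h4 := wedgeOp_mul_mulOp β (α X)
    rw [one_smul]
    linear_combination (norm := noncomm_ring) h1 * wedgeOp β + h2 * wedgeOp α -
      wedgeOp α * h2 - wedgeOp β * h1 - h3 - h4

theorem lieOp_mul_wedgeOp (X : VField n M) (α : OneForm n M) :
    lieOp X * wedgeOp α = wedgeOp α * lieOp X + wedgeOp (lieOneForm X α) := by
  rw [← sub_eq_zero]
  refine formOp_eq_zero (-1) (fun θ => ?_) fun Y => ?_
  · change lieDeriv X (0 : Form n M 0) - (0 + 0) = 0
    rw [add_zero, sub_zero]
    have := lieDeriv_smul X 0 (0 : Form n M 0)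
    rw [zero_smul, zero_smul, dirDeriv_zero, zero_smul, add_zero] at this
    exact this
  · have h1 := iotaOp_mul_wedgeOp Y α
    have h2 := iotaOp_mul_lieOp X Y
    have h3 := lieOp_mul_mulOp X (α Y)
    have h4 := iotaOp_mul_wedgeOp (lieBr X Y) α
    have h5 := iotaOp_mul_wedgeOp Y (lieOneForm X α)
    have h6 : mulOp (dirDeriv X (α Y)) = mulOp (lieOneForm X α Y) + mulOp (α (lieBr X Y)) := by
      rw [← mulOp_add]
      congr 1
      exact (sub_add_cancel _ _).symm
    rw [neg_one_smul]
    linear_combination (norm := noncomm_ring) h2 * wedgeOp α + lieOp X * h1 - h1 * lieOp X +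
      wedgeOp α * h2 + h3 - h4 - h5 + h6

/-- The operator of multiplication with `dα`, as an anticommutator. -/
noncomputable def dWedgeOp (α : OneForm n M) : FormOp n M := wedgeOp α * deRham + deRham * wedgeOp α

theorem iotaOp_mul_dWedgeOp (Y : VField n M) (α : OneForm n M) :
    iotaOp Y * dWedgeOp α = dWedgeOp α * iotaOp Y + wedgeOp (iotaD Y α) := by
  have h1 := iotaOp_mul_wedgeOp Y α
  have h2 := iotaOp_mul_deRham Y
  have h3 := lieOp_mul_wedgeOp Y α
  have h4 := deRham_mul_mulOp (α Y)
  have h5 : wedgeOp (lieOneForm Y α) = wedgeOp (iotaD Y α) + wedgeOp (dFun (α Y)) := by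
    rw [← wedgeOp_add, iotaD, sub_add_cancel]
  rw [dWedgeOp]
  linear_combination (norm := noncomm_ring) h1 * deRham - wedgeOp α * h2 + h2 * wedgeOp α +
    h3 - deRham * h1 - h4 + h5

theorem dWedgeOp_mul_mulOp (α : OneForm n M) (f : SmoothFun n M) :
    dWedgeOp α * mulOp f = mulOp f * dWedgeOp α := by
  have h1 := deRham_mul_mulOp f
  have h2 := wedgeOp_mul_mulOp α f
  have h3 := wedgeOp_mul_wedgeOp α (dFun f)
  rw [dWedgeOp]
  linear_combination (norm := noncomm_ring) wedgeOp α * h1 + h2 * deRham + deRham * h2 +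
    h1 * wedgeOp α + h3

theorem dWedgeOp_mul_wedgeOp (α β : OneForm n M) :
    dWedgeOp α * wedgeOp β = wedgeOp β * dWedgeOp α := by
  rw [← sub_eq_zero]
  refine formOp_eq_zero (-1) (fun θ => ?_) fun Y => ?_
  · change (0 + 0) - 0 = (0 : Form n M 0)
    simp
  · have h1 := iotaOp_mul_dWedgeOp Y α
    have h2 := iotaOp_mul_wedgeOp Y β
    have h3 := dWedgeOp_mul_mulOp α (β Y)
    have h4 := wedgeOp_mul_wedgeOp β (iotaD Y α)
    rw [neg_one_smul]
    linear_combination (norm := noncomm_ring) h1 * wedgeOp β + dWedgeOp α * h2 - h2 * dWedgeOp α +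
      wedgeOp β * h1 + h3 + h4

theorem derivedBracket_deRham (x y : GenSec n M) :
    derivedBracket deRham x y = secOp (dorfman x y) := by
  have h1 := iotaOp_mul_deRham x.1
  have h2 := iotaOp_mul_lieOp x.1 y.1
  have h3 := lieOp_mul_wedgeOp x.1 y.2
  have h4 := iotaOp_mul_dWedgeOp y.1 x.2
  have h5 := dWedgeOp_mul_wedgeOp x.2 y.2
  have h6 : wedgeOp (lieOneForm x.1 y.2) =
      wedgeOp (lieOneForm x.1 y.2 - iotaD y.1 x.2) + wedgeOp (iotaD y.1 x.2) := by
    rw [← wedgeOp_add, sub_add_cancel]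
  rw [derivedBracket, gradedComm, gradedComm]
  simp only [mul_one, pow_one, pow_zero, one_smul, neg_one_smul, sub_neg_eq_add]
  have h7 : secOp x * deRham + deRham * secOp x = lieOp x.1 + dWedgeOp x.2 := by
    rw [secOp, dWedgeOp]
    linear_combination (norm := noncomm_ring) h1
  rw [h7, secOp, secOp, dorfman]
  linear_combination (norm := noncomm_ring) h3 + h5 - h2 - h4 + h6

theorem wedgeOp_unitForm_apply (α : OneForm n M) (X : VField n M) :
    wedgeOp α unitForm 1 ![X] = α X := by
  rw [wedgeOp_apply_succ, wedge_apply]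
  simp [unitForm]

theorem secOp_injective [T2Space M] : Function.Injective (secOp (n := n) (M := M)) := by
  refine (injective_iff_map_eq_zero (secOpHom (n := n) (M := M))).2 fun x hx => ?_
  have hx : secOp x = 0 := hx
  have h2 : x.2 = 0 := by
    ext1 Y
    have h : secOp x unitForm 1 = 0 := by rw [hx]; rfl
    have h' : secOp x unitForm 1 = wedgeOp x.2 unitForm 1 := by
      change (0 : Form n M 2).curryLeft x.1 + wedgeOp x.2 unitForm 1 = _
      rw [AlternatingMap.curryLeft_zero, LinearMap.zero_apply, zero_add]
    rw [← wedgeOp_unitForm_apply, ← h', h]; rfl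
  refine Prod.ext (vField_eq_zero_of_forall_oneForm fun α => ?_) h2
  have h : secOp x (wedgeOp α unitForm) 0 ![] = 0 := by rw [hx]; rfl
  rw [← wedgeOp_unitForm_apply α x.1, ← h]
  exact (add_zero _).symm

end Cartan

/-! ### Existence of the lift to operators on forms -/

section Lift

variable {n : ℕ} {M : Type*} [TopologicalSpace M]
  [ChartedSpace (EuclideanSpace ℝ (Fin n)) M] [IsManifold (𝓡 n) ∞ M]

open AlternatingMap (alternatizeUncurryFin alternatizeUncurryFin_apply)

theorem curryLeft_alternatizeUncurryFin_zero (f : VField n M →ₗ[SmoothFun n M] Form n M 0)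
    (X : VField n M) : (alternatizeUncurryFin f).curryLeft X = f X := by
  refine AlternatingMap.ext fun Y => ?_
  rw [AlternatingMap.curryLeft_apply_apply, alternatizeUncurryFin_apply, Fin.sum_univ_succ]
  simp [Subsingleton.elim _ Y]

theorem curryLeft_alternatizeUncurryFin {k : ℕ} (f : VField n M →ₗ[SmoothFun n M] Form n M (k + 1))
    (g : VField n M →ₗ[SmoothFun n M] Form n M k) (X : VField n M)
    (h : ∀ Y, (f Y).curryLeft X = g Y) :
    (alternatizeUncurryFin f).curryLeft X = f X - alternatizeUncurryFin g := by
  refine AlternatingMap.ext fun Y => ?_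
  rw [AlternatingMap.curryLeft_apply_apply, alternatizeUncurryFin_apply, Fin.sum_univ_succ,
    AlternatingMap.sub_apply, alternatizeUncurryFin_apply, sub_eq_add_neg,
    ← Finset.sum_neg_distrib]
  congr 1
  · simp [Matrix.vecCons]
  · refine Finset.sum_congr rfl fun i _ => ?_
    have : (i.succ.removeNth (Matrix.vecCons X Y) : Fin (k + 1) → VField n M) =
        Matrix.vecCons X (i.removeNth Y) := by
      ext j : 1
      induction j using Fin.cases with
      | zero => rfl
      | succ j => simp [Matrix.vecCons, Fin.removeNth]
    rw [this, ← h, AlternatingMap.curryLeft_apply_apply]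
    simp [pow_succ, Matrix.vecCons]

/-- The action of an endomorphism `A` of `TM` on forms of positive degree as a derivation:
`θ ↦ -∑ i, θ(Y₁, …, A Y_i, …, Y_k)`. -/
noncomputable def endForm {k : ℕ} (A : Module.End (SmoothFun n M) (VField n M))
    (θ : Form n M (k + 1)) : Form n M (k + 1) :=
  -alternatizeUncurryFin (θ.curryLeft ∘ₗ A)

theorem endForm_apply {k : ℕ} (A : Module.End (SmoothFun n M) (VField n M))
    (θ : Form n M (k + 1)) (Y : Fin (k + 1) → VField n M) :
    endForm A θ Y =
      -∑ i : Fin (k + 1), (-1) ^ (i : ℕ) • θ (Matrix.vecCons (A (Y i)) (i.removeNth Y)) :=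
  congrArg Neg.neg (alternatizeUncurryFin_apply (θ.curryLeft ∘ₗ A) Y)

/-- The derivation `θ ↦ -∑ i, θ(Y₁, …, A Y_i, …, Y_k)` as an operator on forms. -/
noncomputable def endOp (A : Module.End (SmoothFun n M) (VField n M)) : FormOp n M where
  toFun θ
    | 0 => 0
    | k + 1 => endForm A (θ (k + 1))
  map_add' θ η := by
    funext k
    cases k with
    | zero => exact (add_zero _).symm
    | succ k =>
      refine AlternatingMap.ext fun Y => ?_
      change endForm A (θ (k + 1) + η (k + 1)) Y =
        endForm A (θ (k + 1)) Y + endForm A (η (k + 1)) Y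
      simp only [endForm_apply, AlternatingMap.add_apply, smul_add, Finset.sum_add_distrib, neg_add]
  map_smul' c θ := by
    funext k
    cases k with
    | zero => exact (smul_zero c).symm
    | succ k =>
      refine AlternatingMap.ext fun Y => ?_
      change endForm A (c • θ (k + 1)) Y = c • endForm A (θ (k + 1)) Y
      simp only [endForm_apply, AlternatingMap.smul_apply, Finset.smul_sum, smul_neg]
      exact congrArg Neg.neg (Finset.sum_congr rfl fun i _ => smul_comm _ _ _)

theorem endOp_apply_zero (A : Module.End (SmoothFun n M) (VField n M)) (θ : TotalForm n M) :
    endOp A θ 0 = 0 := rfl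

theorem endOp_apply_succ (A : Module.End (SmoothFun n M) (VField n M)) (θ : TotalForm n M) (k : ℕ) :
    endOp A θ (k + 1) = -alternatizeUncurryFin ((θ (k + 1)).curryLeft ∘ₗ A) := rfl

theorem iotaOp_mul_endOp (A : Module.End (SmoothFun n M) (VField n M)) (X : VField n M) :
    iotaOp X * endOp A = endOp A * iotaOp X - iotaOp (A X) := by
  refine formOp_ext fun θ k => ?_
  change -(alternatizeUncurryFin ((θ (k + 1)).curryLeft ∘ₗ A)).curryLeft X =
    endOp A (iotaOp X θ) k - (θ (k + 1)).curryLeft (A X)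
  cases k with
  | zero =>
    rw [curryLeft_alternatizeUncurryFin_zero, endOp_apply_zero, zero_sub]; rfl
  | succ k =>
    rw [curryLeft_alternatizeUncurryFin _ (-((iotaOp X θ (k + 1)).curryLeft ∘ₗ A)) X ?_]
    · rw [endOp_apply_succ, neg_sub]
      refine AlternatingMap.ext fun Y => ?_
      simp [alternatizeUncurryFin_apply]
    · intro Y
      exact congrFun (LinearMap.congr_fun (iotaOp_mul_iotaOp X (A Y)) θ) k

theorem endOp_mul_mulOp (A : Module.End (SmoothFun n M) (VField n M)) (f : SmoothFun n M) :
    endOp A * mulOp f = mulOp f * endOp A := by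
  refine formOp_ext fun θ k => ?_
  cases k with
  | zero => exact (smul_zero f).symm
  | succ k =>
    refine AlternatingMap.ext fun Y => ?_
    change endForm A (f • θ (k + 1)) Y = f * endForm A (θ (k + 1)) Y
    simp only [endForm_apply, mul_neg, Finset.mul_sum, mul_smul_comm, AlternatingMap.smul_apply,
      smul_eq_mul]

theorem endOp_mul_wedgeOp (A : Module.End (SmoothFun n M) (VField n M)) (α : OneForm n M) :
    endOp A * wedgeOp α = wedgeOp α * endOp A - wedgeOp (α ∘ₗ A) := by
  rw [← sub_eq_zero]
  refine formOp_eq_zero (-1) (fun θ => ?_) fun X => ?_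
  · change 0 - (0 - 0) = (0 : Form n M 0)
    simp
  · have h1 := iotaOp_mul_wedgeOp X α
    have h2 := iotaOp_mul_endOp A X
    have h3 := endOp_mul_mulOp A (α X)
    have h4 := iotaOp_mul_wedgeOp (A X) α
    have h5 := iotaOp_mul_wedgeOp X (α ∘ₗ A)
    have h6 : mulOp (α (A X)) = mulOp ((α ∘ₗ A) X) := rfl
    rw [neg_one_smul]
    linear_combination (norm := noncomm_ring) h2 * wedgeOp α + endOp A * h1 - h1 * endOp A +
      wedgeOp α * h2 + h3 - h4 + h5 - h6

/-- Wedge multiplication with the one-forms `B Y`, as a linear map of `Y`. -/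
noncomputable def wedgeMap {k : ℕ} (B : VField n M →ₗ[SmoothFun n M] OneForm n M)
    (θ : Form n M k) : VField n M →ₗ[SmoothFun n M] Form n M (k + 1) where
  toFun Y := wedge (B Y) θ
  map_add' X Y := by
    refine AlternatingMap.ext fun Z => ?_
    simp only [wedge_apply, AlternatingMap.add_apply, map_add, LinearMap.add_apply, add_mul,
      mul_add, Finset.sum_add_distrib]
  map_smul' f Y := by
    refine AlternatingMap.ext fun Z => ?_
    simp only [wedge_apply, AlternatingMap.smul_apply, map_smul, LinearMap.smul_apply, smul_eq_mul,
      RingHom.id_apply, Finset.mul_sum]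
    exact Finset.sum_congr rfl fun i _ => by ring

/-- Wedge multiplication with the `2`-form `(X, Y) ↦ B(X)(Y)`. The alternatization counts every pair
of arguments twice. -/
noncomputable def twoFormOp (B : VField n M →ₗ[SmoothFun n M] OneForm n M) : FormOp n M where
  toFun θ
    | 0 => 0
    | 1 => 0
    | k + 2 => (-1 / 2 : ℝ) • alternatizeUncurryFin (wedgeMap B (θ k))
  map_add' θ η := by
    funext k
    match k with
    | 0 => exact (add_zero _).symm
    | 1 => exact (add_zero _).symm
    | k + 2 =>
      refine AlternatingMap.ext fun Y => ?_
      change (-1 / 2 : ℝ) • alternatizeUncurryFin (wedgeMap B (θ k + η k)) Y =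
        (-1 / 2 : ℝ) • alternatizeUncurryFin (wedgeMap B (θ k)) Y +
          (-1 / 2 : ℝ) • alternatizeUncurryFin (wedgeMap B (η k)) Y
      simp only [alternatizeUncurryFin_apply, wedgeMap, LinearMap.coe_mk, AddHom.coe_mk,
        wedge_apply, AlternatingMap.add_apply, mul_add, Finset.sum_add_distrib, smul_add]
  map_smul' c θ := by
    funext k
    match k with
    | 0 => exact (smul_zero c).symm
    | 1 => exact (smul_zero c).symm
    | k + 2 =>
      refine AlternatingMap.ext fun Y => ?_
      change (-1 / 2 : ℝ) • alternatizeUncurryFin (wedgeMap B (c • θ k)) Y =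
        c • (-1 / 2 : ℝ) • alternatizeUncurryFin (wedgeMap B (θ k)) Y
      rw [smul_comm c]
      congr 1
      simp only [alternatizeUncurryFin_apply, wedgeMap, LinearMap.coe_mk, AddHom.coe_mk,
        wedge_apply, AlternatingMap.smul_apply, mul_smul_comm, Finset.smul_sum]
      refine Finset.sum_congr rfl fun i _ => Finset.sum_congr rfl fun j _ => ?_
      rw [smul_comm]

theorem twoFormOp_apply_succ_succ (B : VField n M →ₗ[SmoothFun n M] OneForm n M)
    (θ : TotalForm n M) (k : ℕ) :
    twoFormOp B θ (k + 2) = (-1 / 2 : ℝ) • alternatizeUncurryFin (wedgeMap B (θ k)) := rfl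

theorem twoFormOp_mul_mulOp (B : VField n M →ₗ[SmoothFun n M] OneForm n M) (f : SmoothFun n M) :
    twoFormOp B * mulOp f = mulOp f * twoFormOp B := by
  refine formOp_ext fun θ k => ?_
  match k with
  | 0 => exact (smul_zero f).symm
  | 1 => exact (smul_zero f).symm
  | k + 2 =>
    refine AlternatingMap.ext fun Y => ?_
    change (-1 / 2 : ℝ) • alternatizeUncurryFin (wedgeMap B (f • θ k)) Y =
      f * ((-1 / 2 : ℝ) • alternatizeUncurryFin (wedgeMap B (θ k)) Y)
    rw [mul_smul_comm]
    congr 1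
    simp only [alternatizeUncurryFin_apply, wedgeMap, LinearMap.coe_mk, AddHom.coe_mk,
      wedge_smul, AlternatingMap.smul_apply, Finset.mul_sum, mul_smul_comm, smul_eq_mul]

theorem iotaOp_mul_twoFormOp {B : VField n M →ₗ[SmoothFun n M] OneForm n M}
    (hB : ∀ X Y, B X Y = -B Y X) (X : VField n M) :
    iotaOp X * twoFormOp B = twoFormOp B * iotaOp X - wedgeOp (B X) := by
  have hhalf : ∀ {j : ℕ} (η : Form n M j), (-1 / 2 : ℝ) • (η + η) = -η := by
    intro j η
    rw [← two_smul ℝ η, smul_smul]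
    norm_num
  refine formOp_ext fun θ k => ?_
  cases k with
  | zero => exact (sub_zero _).symm
  | succ k =>
    change ((-1 / 2 : ℝ) • alternatizeUncurryFin (wedgeMap B (θ k))).curryLeft X =
      twoFormOp B (iotaOp X θ) (k + 1) - wedge (B X) (θ k)
    have e : ((-1 / 2 : ℝ) • alternatizeUncurryFin (wedgeMap B (θ k))).curryLeft X =
      (-1 / 2 : ℝ) • (alternatizeUncurryFin (wedgeMap B (θ k))).curryLeft X := rfl
    rw [e]
    cases k with
    | zero =>
      rw [curryLeft_alternatizeUncurryFin _ (-(LinearMap.smulRight (B X) (θ 0))) X fun Y => by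
        refine (curryLeft_wedge_zero (B Y) (θ 0) X).trans ?_
        rw [hB]; exact neg_smul (B X Y) (θ 0)]
      have e1 : wedgeMap B (θ 0) X - alternatizeUncurryFin (-(LinearMap.smulRight (B X) (θ 0))) =
          wedge (B X) (θ 0) + wedge (B X) (θ 0) := by
        refine AlternatingMap.ext fun Y => ?_
        simp [alternatizeUncurryFin_apply, wedgeMap, wedge]
      rw [e1, hhalf]
      exact (zero_sub _).symm
    | succ k =>
      rw [curryLeft_alternatizeUncurryFin _
        (-(LinearMap.smulRight (B X) (θ (k + 1))) - wedgeMap B (iotaOp X θ k)) X fun Y => by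
        refine (curryLeft_wedge (B Y) (θ (k + 1)) X).trans ?_
        rw [hB]
        exact congrArg (· - wedge (B Y) ((θ (k + 1)).curryLeft X)) (neg_smul (B X Y) (θ (k + 1)))]
      have e1 : wedgeMap B (θ (k + 1)) X - alternatizeUncurryFin
          (-(LinearMap.smulRight (B X) (θ (k + 1))) - wedgeMap B (iotaOp X θ k)) =
          (wedge (B X) (θ (k + 1)) + wedge (B X) (θ (k + 1))) +
            alternatizeUncurryFin (wedgeMap B (iotaOp X θ k)) := by
        refine AlternatingMap.ext fun Y => ?_
        simp [alternatizeUncurryFin_apply, wedgeMap, wedge, smul_sub, Finset.sum_sub_distrib]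
        ring
      rw [e1, smul_add, hhalf, twoFormOp_apply_succ_succ]
      abel

theorem twoFormOp_mul_wedgeOp {B : VField n M →ₗ[SmoothFun n M] OneForm n M}
    (hB : ∀ X Y, B X Y = -B Y X) (α : OneForm n M) :
    twoFormOp B * wedgeOp α = wedgeOp α * twoFormOp B := by
  rw [← sub_eq_zero]
  refine formOp_eq_zero (-1) (fun θ => ?_) fun X => ?_
  · exact sub_zero _
  · have h1 := iotaOp_mul_wedgeOp X α
    have h2 := iotaOp_mul_twoFormOp hB X
    have h3 := twoFormOp_mul_mulOp B (α X)
    have h4 := wedgeOp_mul_wedgeOp (B X) α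
    rw [neg_one_smul]
    linear_combination (norm := noncomm_ring) h2 * wedgeOp α + twoFormOp B * h1 -
      h1 * twoFormOp B + wedgeOp α * h2 + h3 - h4

end Lift

section Contraction

variable {n : ℕ} {M : Type*} [TopologicalSpace M]
  [ChartedSpace (EuclideanSpace ℝ (Fin n)) M] [IsManifold (𝓡 n) ∞ M]

theorem iotaOp_sum_smul {ι : Type*} (s : Finset ι) (f : ι → SmoothFun n M)
    (X : ι → VField n M) : iotaOp (∑ i ∈ s, f i • X i) = ∑ i ∈ s, mulOp (f i) * iotaOp (X i) := by
  classical
  induction s using Finset.induction_on with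
  | empty =>
    refine formOp_ext fun θ k => ?_
    exact map_zero (θ (k + 1)).curryLeft
  | insert a s ha ih => rw [Finset.sum_insert ha, Finset.sum_insert ha, iotaOp_add, iotaOp_smul, ih]

/-- `ρ` times twice the contraction with the bivector `(α, β) ↦ β(π α)`, in a dual frame. -/
noncomputable def frameOp (π : OneForm n M →ₗ[SmoothFun n M] VField n M) (F : DualFrame n M) :
    FormOp n M :=
  ∑ i, iotaOp (π (F.ε i)) * iotaOp (F.e i)

/-- Up to the scaling functions, the contraction does not depend on the frame. -/
theorem mulOp_mul_frameOp (π : OneForm n M →ₗ[SmoothFun n M] VField n M) (F G : DualFrame n M) :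
    mulOp G.ρ * frameOp π F = mulOp F.ρ * frameOp π G := by
  have h1 : ∀ i, mulOp G.ρ * iotaOp (F.e i) = ∑ j, mulOp (G.ε j (F.e i)) * iotaOp (G.e j) := by
    intro i
    rw [← iotaOp_smul, ← G.sum_smul, iotaOp_sum_smul]
  have h2 : ∀ j, mulOp F.ρ * iotaOp (π (G.ε j)) =
      ∑ i, mulOp (G.ε j (F.e i)) * iotaOp (π (F.ε i)) := by
    intro j
    rw [← iotaOp_smul, ← map_smul, ← F.sum_smul_oneForm, map_sum, ← iotaOp_sum_smul]
    simp only [map_smul]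
  calc mulOp G.ρ * frameOp π F
      = ∑ i, ∑ j, mulOp (G.ε j (F.e i)) * (iotaOp (π (F.ε i)) * iotaOp (G.e j)) := by
        rw [frameOp, Finset.mul_sum]
        refine Finset.sum_congr rfl fun i _ => ?_
        rw [← mul_assoc, ← iotaOp_mul_mulOp, mul_assoc, h1, Finset.mul_sum]
        refine Finset.sum_congr rfl fun j _ => ?_
        rw [← mul_assoc, iotaOp_mul_mulOp, mul_assoc]
    _ = mulOp F.ρ * frameOp π G := by
        rw [Finset.sum_comm, frameOp, Finset.mul_sum]
        refine Finset.sum_congr rfl fun j _ => ?_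
        rw [← mul_assoc, h2, Finset.sum_mul]
        simp only [mul_assoc]

theorem frameOp_mul_iotaOp (π : OneForm n M →ₗ[SmoothFun n M] VField n M) (F : DualFrame n M)
    (X : VField n M) : frameOp π F * iotaOp X = iotaOp X * frameOp π F := by
  rw [frameOp, Finset.mul_sum, Finset.sum_mul]
  refine Finset.sum_congr rfl fun i _ => ?_
  have h1 := iotaOp_mul_iotaOp X (π (F.ε i))
  have h2 := iotaOp_mul_iotaOp X (F.e i)
  linear_combination (norm := noncomm_ring) iotaOp (π (F.ε i)) * h2 - h1 * iotaOp (F.e i)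

theorem frameOp_mul_wedgeOp {π : OneForm n M →ₗ[SmoothFun n M] VField n M}
    (hπ : ∀ α β : OneForm n M, α (π β) = -β (π α)) (F : DualFrame n M) (α : OneForm n M) :
    frameOp π F * wedgeOp α = wedgeOp α * frameOp π F + 2 • (mulOp F.ρ * iotaOp (π α)) := by
  have h1 : mulOp F.ρ * iotaOp (π α) = ∑ i, mulOp (α (F.e i)) * iotaOp (π (F.ε i)) := by
    rw [← iotaOp_smul, ← map_smul, ← F.sum_smul_oneForm, map_sum, ← iotaOp_sum_smul]
    simp only [map_smul]
  have h2 : mulOp F.ρ * iotaOp (π α) = -∑ i, mulOp (α (π (F.ε i))) * iotaOp (F.e i) := by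
    rw [eq_neg_iff_add_eq_zero, ← iotaOp_smul, ← F.sum_smul, iotaOp_sum_smul,
      ← Finset.sum_add_distrib]
    refine Finset.sum_eq_zero fun i _ => ?_
    rw [← add_mul, ← mulOp_add, hπ α, add_neg_cancel, ← iotaOp_smul, zero_smul]
    exact formOp_ext fun θ k => map_zero (θ (k + 1)).curryLeft
  rw [two_nsmul]
  nth_rewrite 2 [h2]
  rw [h1, frameOp, Finset.mul_sum, Finset.sum_mul, ← Finset.sum_neg_distrib,
    ← Finset.sum_add_distrib, ← Finset.sum_add_distrib]
  refine Finset.sum_congr rfl fun i _ => ?_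
  have h3 := iotaOp_mul_wedgeOp (F.e i) α
  have h4 := iotaOp_mul_wedgeOp (π (F.ε i)) α
  have h5 := iotaOp_mul_mulOp (π (F.ε i)) (α (F.e i))
  linear_combination (norm := noncomm_ring) iotaOp (π (F.ε i)) * h3 - h4 * iotaOp (F.e i) + h5

theorem mulOp_comm (f g : SmoothFun n M) : mulOp f * mulOp g = mulOp g * mulOp f := by
  rw [← mulOp_mul, mul_comm, mulOp_mul]

theorem frameOp_mul_mulOp (π : OneForm n M →ₗ[SmoothFun n M] VField n M) (F : DualFrame n M)
    (f : SmoothFun n M) : frameOp π F * mulOp f = mulOp f * frameOp π F := by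
  rw [frameOp, Finset.mul_sum, Finset.sum_mul]
  rfl

theorem frameOp_apply_eq (π : OneForm n M →ₗ[SmoothFun n M] VField n M) (F G : DualFrame n M)
    (θ : TotalForm n M) (k : ℕ) (Y : Fin k → VField n M) (p : M) :
    G.ρ p * frameOp π F θ k Y p = F.ρ p * frameOp π G θ k Y p :=
  congrArg (fun C : FormOp n M => C θ k Y p) (mulOp_mul_frameOp π F G)

theorem frameOp_apply_eq_zero (π : OneForm n M →ₗ[SmoothFun n M] VField n M) (F : DualFrame n M)
    (θ : TotalForm n M) (k : ℕ) (h : θ (k + 2) = 0) : frameOp π F θ k = 0 := by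
  have h1 : ∀ i, (iotaOp (π (F.ε i)) * iotaOp (F.e i)) θ k = 0 := by
    intro i
    change ((θ (k + 2)).curryLeft (F.e i)).curryLeft (π (F.ε i)) = 0
    rw [h]; rfl
  have h2 : ∀ s : Finset (Fin n), (∑ i ∈ s, iotaOp (π (F.ε i)) * iotaOp (F.e i)) θ k = 0 := by
    intro s
    induction s using Finset.induction_on with
    | empty => rfl
    | insert a s ha ih =>
      rw [Finset.sum_insert ha, LinearMap.add_apply, totalForm_add_apply, ih, h1, add_zero]
  exact h2 _

theorem endOp_apply_eq_zero (A : Module.End (SmoothFun n M) (VField n M))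
    (θ : TotalForm n M) (k : ℕ) (h : θ k = 0) : endOp A θ k = 0 := by
  cases k with
  | zero => rfl
  | succ k =>
    refine AlternatingMap.ext fun Y => ?_
    change endForm A (θ (k + 1)) Y = 0
    rw [h, endForm_apply]
    simp

variable [T2Space M]

/-- A dual frame near a given point. -/
noncomputable def dualFrameAt (p : M) : DualFrame n M := (exists_dualFrame p).choose

theorem dualFrameAt_ρ_ne_zero (p : M) : (dualFrameAt (n := n) p).ρ p ≠ 0 :=
  (exists_dualFrame p).choose_spec

theorem smoothFun_ext_dualFrame {f g : SmoothFun n M}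
    (h : ∀ F : DualFrame n M, F.ρ * f = F.ρ * g) : f = g := by
  ext p
  have h1 : (dualFrameAt (n := n) p).ρ p * f p = (dualFrameAt (n := n) p).ρ p * g p :=
    congrArg (fun f : SmoothFun n M => f p) (h (dualFrameAt p))
  exact mul_left_cancel₀ (dualFrameAt_ρ_ne_zero p) h1

theorem formOp_ext_dualFrame {A B : FormOp n M}
    (h : ∀ F : DualFrame n M, mulOp F.ρ * A = mulOp F.ρ * B) : A = B :=
  formOp_ext fun θ k => AlternatingMap.ext fun Y => smoothFun_ext_dualFrame fun F =>
    congrArg (fun C : FormOp n M => C θ k Y) (h F)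

/-- The values of the contraction of a form with a bivector; at every point, they are computed
in a dual frame near that point. -/
noncomputable def contractionFun (π : OneForm n M →ₗ[SmoothFun n M] VField n M)
    (θ : TotalForm n M) (k : ℕ) (Y : Fin k → VField n M) : SmoothFun n M where
  val p := ((dualFrameAt (n := n) p).ρ p)⁻¹ * frameOp π (dualFrameAt p) θ k Y p
  property := by
    intro p
    let F : DualFrame n M := dualFrameAt p
    have hF : F.ρ p ≠ 0 := dualFrameAt_ρ_ne_zero p
    -- near `p`, the frames at the other points may be replaced by the frame at `p`
    have h1 : ContMDiffAt (𝓡 n) 𝓘(ℝ, ℝ) ∞ (fun q => (F.ρ q)⁻¹ * frameOp π F θ k Y q) p :=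
      (ContMDiffAt.inv₀ (F.ρ.contMDiff p) hF).mul ((frameOp π F θ k Y).contMDiff p)
    refine h1.congr_of_eventuallyEq ?_
    filter_upwards [F.ρ.contMDiff.continuous.continuousAt.eventually_ne hF] with q hq
    have hG := dualFrameAt_ρ_ne_zero (n := n) q
    have := frameOp_apply_eq π F (dualFrameAt q) θ k Y q
    field_simp
    linarith

theorem ρ_mul_contractionFun (π : OneForm n M →ₗ[SmoothFun n M] VField n M) (F : DualFrame n M)
    (θ : TotalForm n M) (k : ℕ) (Y : Fin k → VField n M) :
    F.ρ * contractionFun π θ k Y = frameOp π F θ k Y := by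
  ext p
  change F.ρ p * (((dualFrameAt (n := n) p).ρ p)⁻¹ * frameOp π (dualFrameAt p) θ k Y p) = _
  have hG := dualFrameAt_ρ_ne_zero (n := n) p
  have := frameOp_apply_eq π F (dualFrameAt p) θ k Y p
  field_simp
  linarith

/-- Twice the contraction with the bivector `(α, β) ↦ β(π α)`, as an operator on forms. -/
noncomputable def contractionOp (π : OneForm n M →ₗ[SmoothFun n M] VField n M) : FormOp n M where
  toFun θ k :=
    { toFun := contractionFun π θ k
      map_update_add' := fun {inst} Y j A B => by
        refine smoothFun_ext_dualFrame fun F => ?_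
        rw [mul_add]
        simp only [ρ_mul_contractionFun]
        exact (frameOp π F θ k).map_update_add Y j A B
      map_update_smul' := fun {inst} Y j f A => by
        refine smoothFun_ext_dualFrame fun F => ?_
        rw [smul_eq_mul, mul_left_comm]
        simp only [ρ_mul_contractionFun]
        exact (frameOp π F θ k).map_update_smul Y j f A
      map_eq_zero_of_eq' := fun Y i j hij hne => by
        refine smoothFun_ext_dualFrame fun F => ?_
        rw [ρ_mul_contractionFun, mul_zero]
        exact (frameOp π F θ k).map_eq_zero_of_eq Y hij hne }
  map_add' θ η := by
    funext k
    refine AlternatingMap.ext fun Y => smoothFun_ext_dualFrame fun F => ?_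
    change F.ρ * contractionFun π (θ + η) k Y =
      F.ρ * (contractionFun π θ k Y + contractionFun π η k Y)
    rw [mul_add, ρ_mul_contractionFun, ρ_mul_contractionFun, ρ_mul_contractionFun, map_add]
    rfl
  map_smul' c θ := by
    funext k
    refine AlternatingMap.ext fun Y => smoothFun_ext_dualFrame fun F => ?_
    change F.ρ * contractionFun π (c • θ) k Y = F.ρ * (c • contractionFun π θ k Y)
    rw [mul_smul_comm, ρ_mul_contractionFun, ρ_mul_contractionFun, map_smul]
    rfl

theorem mulOp_mul_contractionOp (π : OneForm n M →ₗ[SmoothFun n M] VField n M)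
    (F : DualFrame n M) : mulOp F.ρ * contractionOp π = frameOp π F :=
  formOp_ext fun θ k => AlternatingMap.ext fun Y => ρ_mul_contractionFun π F θ k Y

theorem contractionOp_mul_mulOp (π : OneForm n M →ₗ[SmoothFun n M] VField n M)
    (f : SmoothFun n M) : contractionOp π * mulOp f = mulOp f * contractionOp π := by
  refine formOp_ext_dualFrame fun F => ?_
  rw [← mul_assoc, mulOp_mul_contractionOp, ← mul_assoc, mulOp_comm, mul_assoc,
    mulOp_mul_contractionOp, frameOp_mul_mulOp]

theorem contractionOp_mul_iotaOp (π : OneForm n M →ₗ[SmoothFun n M] VField n M)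
    (X : VField n M) : contractionOp π * iotaOp X = iotaOp X * contractionOp π := by
  refine formOp_ext_dualFrame fun F => ?_
  rw [← mul_assoc, mulOp_mul_contractionOp, ← mul_assoc, ← iotaOp_mul_mulOp, mul_assoc,
    mulOp_mul_contractionOp, frameOp_mul_iotaOp]

theorem contractionOp_mul_wedgeOp {π : OneForm n M →ₗ[SmoothFun n M] VField n M}
    (hπ : ∀ α β : OneForm n M, α (π β) = -β (π α)) (α : OneForm n M) :
    contractionOp π * wedgeOp α = wedgeOp α * contractionOp π + 2 • iotaOp (π α) := by
  refine formOp_ext_dualFrame fun F => ?_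
  rw [← mul_assoc, mulOp_mul_contractionOp, mul_add, ← mul_assoc, ← wedgeOp_mul_mulOp, mul_assoc,
    mulOp_mul_contractionOp, frameOp_mul_wedgeOp hπ, mul_smul_comm]

theorem contractionOp_apply_eq_zero (π : OneForm n M →ₗ[SmoothFun n M] VField n M)
    (θ : TotalForm n M) (k : ℕ) (h : θ (k + 2) = 0) : contractionOp π θ k = 0 := by
  refine AlternatingMap.ext fun Y => smoothFun_ext_dualFrame fun F => ?_
  refine (ρ_mul_contractionFun π F θ k Y).trans ?_
  rw [frameOp_apply_eq_zero π F θ k h, AlternatingMap.zero_apply]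
  exact (mul_zero F.ρ).symm

end Contraction

section LiftExistence

variable {n : ℕ} {M : Type*} [TopologicalSpace M]
  [ChartedSpace (EuclideanSpace ℝ (Fin n)) M] [IsManifold (𝓡 n) ∞ M]

/-- In blocks with respect to `𝕋M = TM ⊕ T*M`, a skew-symmetric endomorphism consists of an
endomorphism of `TM`, a `2`-form and a bivector; they act on forms as a derivation, by wedge
multiplication and by contraction, and the sum of these operators is the lift. -/
theorem exists_isLift [T2Space M] {φ : GenEnd n M} (hφ : IsSkew φ) :
    ∃ Φ : FormOp n M, IsLift φ Φ := by
  have hskew : ∀ x y : GenSec n M,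
      ((φ x).2 y.1 + y.2 (φ x).1) + (x.2 (φ y).1 + (φ y).2 x.1) = 0 := fun x y => by
    rw [← two_smul_tautInner, ← two_smul_tautInner, ← smul_add, hφ, smul_zero]
  let A : Module.End (SmoothFun n M) (VField n M) :=
    LinearMap.fst _ _ _ ∘ₗ φ ∘ₗ LinearMap.inl _ _ _
  let B : VField n M →ₗ[SmoothFun n M] OneForm n M :=
    LinearMap.snd _ _ _ ∘ₗ φ ∘ₗ LinearMap.inl _ _ _
  let π : OneForm n M →ₗ[SmoothFun n M] VField n M :=
    LinearMap.fst _ _ _ ∘ₗ φ ∘ₗ LinearMap.inr _ _ _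
  have hB : ∀ X Y, B X Y = -B Y X := fun X Y => by
    have := hskew (X, 0) (Y, 0)
    simp only [LinearMap.zero_apply, add_zero, zero_add] at this
    exact eq_neg_of_add_eq_zero_left this
  have hπ : ∀ α β : OneForm n M, α (π β) = -β (π α) := fun α β => by
    have := hskew (0, α) (0, β)
    simp only [map_zero, add_zero, zero_add] at this
    exact eq_neg_of_add_eq_zero_right this
  have hA : ∀ α : OneForm n M, (φ (0, α)).2 = -(α ∘ₗ A) := fun α => by
    ext1 X
    have := hskew (0, α) (X, 0)
    simp only [map_zero, add_zero, LinearMap.zero_apply] at this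
    exact eq_neg_of_add_eq_zero_left this
  have hdecomp : ∀ x : GenSec n M, φ x = (A x.1 + π x.2, B x.1 - x.2 ∘ₗ A) := fun x => by
    have h1 : x = (x.1, 0) + (0, x.2) := by simp
    conv_lhs => rw [h1, map_add]
    refine Prod.ext rfl ?_
    rw [Prod.snd_add, hA, ← sub_eq_add_neg]
    rfl
  have hval : ∀ (θ : TotalForm n M) (k : ℕ),
      (endOp A + twoFormOp B + (1 / 2 : ℝ) • contractionOp π) θ k =
        endOp A θ k + twoFormOp B θ k + (1 / 2 : ℝ) • contractionOp π θ k := fun _ _ => rfl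
  have htwo : ∀ (θ : TotalForm n M) (k : ℕ), (∀ j, j + 2 = k → θ j = 0) →
      twoFormOp B θ k = 0 := by
    intro θ k h
    match k with
    | 0 => rfl
    | 1 => rfl
    | k + 2 =>
      refine AlternatingMap.ext fun Y => ?_
      rw [twoFormOp_apply_succ_succ, h k rfl]
      simp [AlternatingMap.alternatizeUncurryFin_apply, wedgeMap, wedge_apply]
  have hsum : ∀ (θ : TotalForm n M) (k : ℕ), θ k = 0 → (∀ j, j + 2 = k → θ j = 0) →
      θ (k + 2) = 0 → (endOp A + twoFormOp B + (1 / 2 : ℝ) • contractionOp π) θ k = 0 := by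
    intro θ k h1 h2 h3
    rw [hval, endOp_apply_eq_zero A θ k h1, htwo θ k h2, contractionOp_apply_eq_zero π θ k h3,
      smul_zero, add_zero, add_zero]
  refine ⟨endOp A + twoFormOp B + (1 / 2 : ℝ) • contractionOp π, ?_, ?_, ?_, ?_, ?_⟩
  · intro θ h k hk
    refine hsum θ k (h k hk) (fun j hj => h j ?_) (h _ (by simpa [Nat.odd_add] using hk))
    rw [← hj] at hk
    simpa [Nat.odd_add] using hk
  · intro θ h k hk
    refine hsum θ k (h k hk) (fun j hj => h j ?_) (h _ (by simpa [Nat.even_add] using hk))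
    rw [← hj] at hk
    simpa [Nat.even_add] using hk
  · intro f
    rw [gradedComm, mul_zero, pow_zero, one_smul, add_mul, add_mul, mul_add, mul_add,
      smul_mul_assoc, mul_smul_comm, endOp_mul_mulOp, twoFormOp_mul_mulOp, contractionOp_mul_mulOp,
      sub_self]
  · intro x
    have h1 := iotaOp_mul_endOp A x.1
    have h2 := endOp_mul_wedgeOp A x.2
    have h3 := iotaOp_mul_twoFormOp hB x.1
    have h4 := twoFormOp_mul_wedgeOp hB x.2
    have h5 := contractionOp_mul_iotaOp π x.1
    have h6 := contractionOp_mul_wedgeOp hπ x.2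
    have h5' : (1 / 2 : ℝ) • (contractionOp π * iotaOp x.1 - iotaOp x.1 * contractionOp π) = 0 := by
      rw [h5, sub_self, smul_zero]
    have h6' : (1 / 2 : ℝ) • (contractionOp π * wedgeOp x.2 - wedgeOp x.2 * contractionOp π) =
        iotaOp (π x.2) := by
      rw [h6, add_sub_cancel_left, ← Nat.cast_smul_eq_nsmul ℝ, smul_smul]
      norm_num
    have h7 : wedgeOp (B x.1) = wedgeOp (B x.1 - x.2 ∘ₗ A) + wedgeOp (x.2 ∘ₗ A) := by
      rw [← wedgeOp_add, sub_add_cancel]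
    have h8 := iotaOp_add (A x.1) (π x.2)
    rw [hdecomp, gradedComm, secOp, secOp, zero_mul, pow_zero, one_smul, h8]
    rw [smul_sub] at h5' h6'
    simp only [mul_add, add_mul, smul_mul_assoc, mul_smul_comm]
    linear_combination (norm := module) h2 + h4 + h5' + h6' - h1 - h3 + h7
  · intro k hk
    match k with
    | 0 =>
      rw [hval, endOp_apply_zero, htwo _ _ (fun j hj => by omega),
        contractionOp_apply_eq_zero π _ _ rfl, smul_zero, add_zero, add_zero]
    | 1 => exact hsum _ _ rfl (fun j hj => by omega) rfl
    | 2 => exact absurd rfl hk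
    | k + 3 => exact hsum _ _ rfl (fun j hj => by obtain rfl : j = k + 1 := by omega
                                                  rfl) rfl

end LiftExistence

/-! ### Derived brackets and torsions -/

section Minimality

variable {n : ℕ} {M : Type*} [TopologicalSpace M]
  [ChartedSpace (EuclideanSpace ℝ (Fin n)) M] [IsManifold (𝓡 n) ∞ M]

theorem derivedBracket_eq (δ : FormOp n M) (x y : GenSec n M) :
    derivedBracket δ x y =
      (secOp x * δ + δ * secOp x) * secOp y - secOp y * (secOp x * δ + δ * secOp x) := by
  rw [derivedBracket, gradedComm, gradedComm]
  simp only [mul_one, pow_one, pow_zero, one_smul, neg_one_smul, sub_neg_eq_add]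

theorem derivedBracket_add_op (δ δ' : FormOp n M) (x y : GenSec n M) :
    derivedBracket (δ + δ') x y = derivedBracket δ x y + derivedBracket δ' x y := by
  simp only [derivedBracket_eq]; noncomm_ring

theorem derivedBracket_smul_op (c : ℝ) (δ : FormOp n M) (x y : GenSec n M) :
    derivedBracket (c • δ) x y = c • derivedBracket δ x y := by
  simp only [derivedBracket_eq, mul_smul_comm, smul_mul_assoc, ← smul_add, ← smul_sub]

theorem derivedBracket_add_left (δ : FormOp n M) (x x' y : GenSec n M) :
    derivedBracket δ (x + x') y = derivedBracket δ x y + derivedBracket δ x' y := by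
  simp only [derivedBracket_eq, secOp_add]; noncomm_ring

theorem derivedBracket_add_right (δ : FormOp n M) (x y y' : GenSec n M) :
    derivedBracket δ x (y + y') = derivedBracket δ x y + derivedBracket δ x y' := by
  simp only [derivedBracket_eq, secOp_add]; noncomm_ring

theorem derivedBracket_smul_left (δ : FormOp n M) (c : ℝ) (x y : GenSec n M) :
    derivedBracket δ (c • x) y = c • derivedBracket δ x y := by
  simp only [derivedBracket_eq, ← secOpHom_apply, map_smul, mul_smul_comm, smul_mul_assoc,
    ← smul_add, ← smul_sub]

theorem derivedBracket_smul_right (δ : FormOp n M) (c : ℝ) (x y : GenSec n M) :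
    derivedBracket δ x (c • y) = c • derivedBracket δ x y := by
  simp only [derivedBracket_eq, ← secOpHom_apply, map_smul, mul_smul_comm, smul_mul_assoc,
    ← smul_sub]

/-- The Dorfman bracket as a bilinear map over the reals. -/
noncomputable def dorfmanBilin (n : ℕ) (M : Type*) [TopologicalSpace M] [T2Space M]
    [ChartedSpace (EuclideanSpace ℝ (Fin n)) M] [IsManifold (𝓡 n) ∞ M] :
    GenSec n M →ₗ[ℝ] GenSec n M →ₗ[ℝ] GenSec n M :=
  LinearMap.mk₂ ℝ dorfman
    (fun x x' y => secOp_injective <| by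
      rw [secOp_add]; simp only [← derivedBracket_deRham, derivedBracket_add_left])
    (fun c x y => secOp_injective <| by
      rw [← secOpHom_apply (c • _), map_smul, secOpHom_apply]
      simp only [← derivedBracket_deRham, derivedBracket_smul_left])
    (fun x y y' => secOp_injective <| by
      rw [secOp_add]; simp only [← derivedBracket_deRham, derivedBracket_add_right])
    (fun c x y => secOp_injective <| by
      rw [← secOpHom_apply (c • _), map_smul, secOpHom_apply]
      simp only [← derivedBracket_deRham, derivedBracket_smul_right])

variable {φ : GenEnd n M} {Φ : FormOp n M}

theorem IsLift.mul_secOp (h : IsLift φ Φ) (x : GenSec n M) :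
    Φ * secOp x = secOp x * Φ + secOp (φ x) := by
  have := h.comm_sec x
  rw [gradedComm, zero_mul, pow_zero, one_smul] at this
  rw [← this]; abel

/-- The adjoint action of a lift is a derivation of the derived bracket. -/
theorem derivedBracket_adOp (h : IsLift φ Φ) (δ : FormOp n M) (x y : GenSec n M) :
    derivedBracket (adOp Φ δ) x y =
      Φ * derivedBracket δ x y - derivedBracket δ x y * Φ - derivedBracket δ (φ x) y -
        derivedBracket δ x (φ y) := by
  have hx := h.mul_secOp x
  have hy := h.mul_secOp y
  have e : adOp Φ δ = Φ * δ - δ * Φ := rfl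
  simp only [derivedBracket_eq, e]
  have hx' : secOp (φ x) = Φ * secOp x - secOp x * Φ := by rw [hx]; abel
  have hy' : secOp (φ y) = Φ * secOp y - secOp y * Φ := by rw [hy]; abel
  rw [hx', hy']
  noncomm_ring

/-- The pairs of an operator `δ` and a bilinear operation that is the derived bracket of `δ`. -/
noncomputable def derivedBracketGraph (n : ℕ) (M : Type*) [TopologicalSpace M]
    [ChartedSpace (EuclideanSpace ℝ (Fin n)) M] [IsManifold (𝓡 n) ∞ M] :
    Submodule ℝ (FormOp n M × (GenSec n M →ₗ[ℝ] GenSec n M →ₗ[ℝ] GenSec n M)) where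
  carrier := {δB | ∀ x y, derivedBracket δB.1 x y = secOp (δB.2 x y)}
  add_mem' {a b} ha hb x y := by
    refine (derivedBracket_add_op a.1 b.1 x y).trans ?_
    rw [ha, hb]
    exact (secOp_add _ _).symm
  zero_mem' x y := by
    have := derivedBracket_smul_op 0 (0 : FormOp n M) x y
    rw [zero_smul, zero_smul] at this
    exact this.trans secOpHom.map_zero.symm
  smul_mem' c a ha x y := by
    refine (derivedBracket_smul_op c a.1 x y).trans ?_
    rw [ha]
    exact (secOpHom.map_smul c _).symm

theorem mem_derivedBracketGraph {δ : FormOp n M}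
    {B : GenSec n M →ₗ[ℝ] GenSec n M →ₗ[ℝ] GenSec n M} :
    (δ, B) ∈ derivedBracketGraph n M ↔ ∀ x y, derivedBracket δ x y = secOp (B x y) := Iff.rfl

theorem adOp_mem_derivedBracketGraph (h : IsLift φ Φ) {δ : FormOp n M}
    {B : GenSec n M →ₗ[ℝ] GenSec n M →ₗ[ℝ] GenSec n M} (hB : (δ, B) ∈ derivedBracketGraph n M) :
    (adOp Φ δ, bilinAd (φ.restrictScalars ℝ) B) ∈ derivedBracketGraph n M := by
  rw [mem_derivedBracketGraph] at hB ⊢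
  intro x y
  rw [bilinAd_apply, derivedBracket_adOp h, hB, hB, hB, h.mul_secOp, add_sub_cancel_left, ← secOp_sub,
    ← secOp_sub]
  rfl

theorem aeval_mem_of_invariant {V W : Type*} [AddCommMonoid V] [Module ℝ V] [AddCommMonoid W]
    [Module ℝ W] {R : Submodule ℝ (V × W)} {S : Module.End ℝ V} {T : Module.End ℝ W}
    (hR : ∀ v w, (v, w) ∈ R → (S v, T w) ∈ R) (P : ℝ[X]) {v : V} {w : W} (hvw : (v, w) ∈ R) :
    (Polynomial.aeval S P v, Polynomial.aeval T P w) ∈ R := by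
  induction P using Polynomial.induction_on' with
  | add p q hp hq =>
    rw [map_add, map_add]
    exact R.add_mem hp hq
  | monomial k c =>
    have hk : ((S ^ k) v, (T ^ k) w) ∈ R := by
      induction k with
      | zero => exact hvw
      | succ k ih =>
        rw [pow_succ', pow_succ']
        exact hR _ _ ih
    simp only [Polynomial.aeval_monomial, Algebra.algebraMap_eq_smul_one, smul_mul_assoc, one_mul]
    exact R.smul_mem c hk

/-- If the derived bracket of `δ` is a bilinear operation on sections, then so is the derived bracket
of `P(ad_Φ)(δ)`. -/
theorem derivedBracket_aeval_adOp (h : IsLift φ Φ) {δ : FormOp n M}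
    {B : GenSec n M →ₗ[ℝ] GenSec n M →ₗ[ℝ] GenSec n M}
    (hB : ∀ x y, derivedBracket δ x y = secOp (B x y)) (P : ℝ[X]) (x y : GenSec n M) :
    derivedBracket (Polynomial.aeval (adOp Φ) P δ) x y =
      secOp (Polynomial.aeval (bilinAd (φ.restrictScalars ℝ)) P B x y) :=
  mem_derivedBracketGraph.1 (aeval_mem_of_invariant (R := derivedBracketGraph n M)
    (fun _ _ => adOp_mem_derivedBracketGraph h) P (mem_derivedBracketGraph.2 hB)) x y

theorem isGenNijenhuis_iff [T2Space M] (ψ : GenEnd n M) :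
    IsGenNijenhuis ψ ↔ bilinTorsion (ψ.restrictScalars ℝ) (dorfmanBilin n M) = 0 :=
  ⟨fun h => LinearMap.ext₂ h, fun h x y => LinearMap.congr_fun₂ h x y⟩

/-- The minimal torsion vanishes exactly when the torsions of the semisimple and of the nilpotent
part do. -/
theorem derivedBracket_minimalOperator_eq_zero_iff [T2Space M] (h : IsLift φ Φ) {s ν : GenEnd n M}
    {c : ℝ} (hc : c ≠ 0) (hφ : s + ν = φ) (hcomm : Commute s ν)
    (hs : s * s = algebraMap ℝ (GenEnd n M) c) (hν : ν * ν = 0) :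
    (∀ x y, derivedBracket
        (minimalOperator Φ ((Polynomial.X ^ 2 - Polynomial.C c) ^ 2)) x y = 0) ↔
      IsGenNijenhuis s ∧ IsGenNijenhuis ν := by
  have key := aeval_bilinAd_eq_zero_iff (s := s.restrictScalars ℝ) (ν := ν.restrictScalars ℝ) hc
    (LinearMap.ext fun x => LinearMap.congr_fun hcomm.eq x)
    (LinearMap.ext fun x => LinearMap.congr_fun hs x)
    (LinearMap.ext fun x => LinearMap.congr_fun hν x) (dorfmanBilin n M)
  rw [isGenNijenhuis_iff, isGenNijenhuis_iff, ← key]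
  have e : s.restrictScalars ℝ + ν.restrictScalars ℝ = φ.restrictScalars ℝ := by rw [← hφ]; rfl
  rw [e]
  have hB : ∀ x y, derivedBracket deRham x y = secOp (dorfmanBilin n M x y) :=
    derivedBracket_deRham
  constructor
  · intro h0
    refine LinearMap.ext₂ fun x y => secOp_injective ?_
    rw [← derivedBracket_aeval_adOp h hB]
    exact (h0 x y).trans (secOpHom (n := n) (M := M)).map_zero.symm
  · intro h0 x y
    rw [minimalOperator, derivedBracket_aeval_adOp h hB, h0]
    exact (secOpHom (n := n) (M := M)).map_zero

end Minimality

/-! ### Polynomials with two opposite double roots -/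

section Polynomials

open Polynomial

/-- A real quartic that is an even function and has exactly two complex roots is the square of a
polynomial `X² - c`. -/
theorem exists_eq_sq_of_ncard_roots {P : ℝ[X]} (hP : P.Monic) (hdeg : P.natDegree = 4)
    (heven : P.comp (-X) = P) (hroots : {z : ℂ | aeval z P = 0}.ncard = 2) :
    ∃ c : ℝ, c ≠ 0 ∧ P = (X ^ 2 - C c) ^ 2 := by
  have hcoeff : ∀ k, Odd k → P.coeff k = 0 := by
    intro k hk
    have h := congrArg (fun Q : ℝ[X] => Q.coeff k) heven
    have e : (-X : ℝ[X]) = C (-1) * X := by simp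
    simp only [e, Polynomial.comp_C_mul_X_coeff, hk.neg_one_pow] at h
    linarith
  have hPX : P = X ^ 4 + C (P.coeff 2) * X ^ 2 + C (P.coeff 0) := by
    have h4 : P.coeff 4 = 1 := by rw [← hdeg]; exact hP
    conv_lhs => rw [P.as_sum_range_C_mul_X_pow, hdeg]
    simp [Finset.sum_range_succ, h4, hcoeff 1 (by decide), hcoeff 3 (by decide)]
    ring
  set a := P.coeff 2
  set b := P.coeff 0
  have hmem : ∀ z : ℂ, aeval z P = 0 ↔ z ^ 4 + a * z ^ 2 + b = 0 := by
    intro z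
    rw [hPX]; simp
  obtain ⟨z, w, hzw, hset⟩ := Set.ncard_eq_two.1 hroots
  have hin : ∀ x : ℂ, x ^ 4 + a * x ^ 2 + b = 0 ↔ x = z ∨ x = w := by
    intro x
    rw [← hmem]
    have : x ∈ {z : ℂ | aeval z P = 0} ↔ x ∈ ({z, w} : Set ℂ) := by rw [hset]
    simpa using this
  have hneg : ∀ x : ℂ, (x = z ∨ x = w) → (-x = z ∨ -x = w) := by
    intro x hx
    rw [← hin] at hx ⊢
    linear_combination hx
  have hz := (hin z).2 (Or.inl rfl)
  -- the two roots are opposite to each other and nonzero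
  have hw : w = -z ∧ z ≠ 0 := by
    rcases hneg z (Or.inl rfl) with h | h
    · have hz0 : z = 0 := by linear_combination (-1 / 2 : ℂ) * h
      rcases hneg w (Or.inr rfl) with h' | h'
      · refine absurd ?_ hzw
        linear_combination 2 * hz0 + h'
      · have hw0 : w = 0 := by linear_combination (-1 / 2 : ℂ) * h'
        exact absurd (hz0.trans hw0.symm) hzw
    · refine ⟨h.symm, fun h0 => hzw ?_⟩
      rw [← h, h0, neg_zero]
  -- the square of any root of the second factor is the same number
  obtain ⟨t, ht⟩ := IsAlgClosed.exists_pow_nat_eq (-a - z ^ 2 : ℂ) (n := 2) (by norm_num)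
  have htz : t ^ 2 = z ^ 2 := by
    have : t ^ 4 + a * t ^ 2 + b = 0 := by
      have : t ^ 4 = (t ^ 2) ^ 2 := by ring
      rw [this, ht]; linear_combination hz
    rcases (hin t).1 this with h | h
    · rw [h]
    · rw [h, hw.1]; ring
  have hzc : z ^ 2 = ((-a / 2 : ℝ) : ℂ) := by
    push_cast
    linear_combination (1 / 2 : ℂ) * (ht - htz)
  have hb : b = (a / 2) ^ 2 := by
    have : ((b : ℝ) : ℂ) = (((a / 2) ^ 2 : ℝ) : ℂ) := by
      push_cast at hzc ⊢
      linear_combination hz - (z ^ 2 + a / 2) * hzc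
    exact_mod_cast this
  refine ⟨-a / 2, fun h0 => hw.2 ?_, ?_⟩
  · rw [h0] at hzc
    simpa using hzc
  · rw [hPX, hb]
    have : C a = -2 * C (-a / 2) := by
      rw [show (-2 : ℝ[X]) = C (-2) by rw [C_neg]; rfl, ← C_mul]; congr 1; ring
    have h2 : C ((a / 2) ^ 2) = C (-a / 2) ^ 2 := by rw [← C_pow]; congr 1; ring
    rw [this, h2]; ring

theorem minpoly_eq_sq_iff {V : Type*} [AddCommGroup V] [Module ℝ V] {f : Module.End ℝ V} {q : ℝ[X]}
    (hq : Irreducible q) (hm : q.Monic) (h : aeval f (q ^ 2) = 0) :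
    minpoly ℝ f = q ^ 2 ↔ aeval f q ≠ 0 := by
  have hint : IsIntegral ℝ f := ⟨q ^ 2, hm.pow 2, h⟩
  constructor
  · intro hmin h0
    have hdvd : q ^ 2 ∣ q := hmin ▸ minpoly.dvd ℝ f h0
    rw [pow_two] at hdvd
    have := hq.not_isUnit
    exact this (isUnit_of_dvd_one ((mul_dvd_mul_iff_left hq.ne_zero).1 (by rwa [mul_one])))
  · intro h0
    obtain ⟨i, hi, hassoc⟩ := (dvd_prime_pow hq.prime 2).1 (minpoly.dvd ℝ f h)
    have he := eq_of_monic_of_associated (minpoly.monic hint) (hm.pow i) hassoc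
    have hi2 : i = 2 := by
      by_contra hne
      have : i ≤ 1 := by omega
      have hd : minpoly ℝ f ∣ q := by
        rw [he]; simpa using pow_dvd_pow q this
      obtain ⟨r, hr⟩ := hd
      exact h0 (by rw [hr, map_mul, minpoly.aeval, zero_mul])
    rw [he, hi2]

/-- The semisimple part of an element with `(a² - c)² = 0`. -/
noncomputable def ssPart {A : Type*} [Ring A] [Algebra ℝ A] (c : ℝ) (a : A) : A :=
  aeval a (C (2 * c)⁻¹ * (C (3 * c) * X - X ^ 3))

/-- The nilpotent part of an element with `(a² - c)² = 0`. -/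
noncomputable def nilPart {A : Type*} [Ring A] [Algebra ℝ A] (c : ℝ) (a : A) : A :=
  aeval a (C (2 * c)⁻¹ * (X ^ 3 - C c * X))

section

variable {A : Type*} [Ring A] [Algebra ℝ A] {c : ℝ} {a : A}

theorem ssPart_add_nilPart (hc : c ≠ 0) : ssPart c a + nilPart c a = a := by
  have h : C (2 * c)⁻¹ * (C (3 * c) * X - X ^ 3) + C (2 * c)⁻¹ * (X ^ 3 - C c * X) = X := by
    rw [← mul_add, sub_add_sub_cancel, ← sub_mul, ← C_sub, ← mul_assoc, ← C_mul]
    have : (2 * c)⁻¹ * (3 * c - c) = 1 := by field_simp; ring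
    rw [this, C_1, one_mul]
  rw [ssPart, nilPart, ← map_add, h, aeval_X]

theorem commute_ssPart_nilPart : Commute (ssPart c a) (nilPart c a) := by
  rw [Commute, SemiconjBy, ssPart, nilPart, ← map_mul, ← map_mul, mul_comm]

theorem ssPart_mul_self (hc : c ≠ 0) (ha : aeval a ((X ^ 2 - C c) ^ 2) = 0) :
    ssPart c a * ssPart c a = algebraMap ℝ A c := by
  have h : (C (2 * c)⁻¹ * (C (3 * c) * X - X ^ 3)) * (C (2 * c)⁻¹ * (C (3 * c) * X - X ^ 3)) =
      C c + (C (2 * c)⁻¹ ^ 2 * (X ^ 2 - 4 * C c)) * (X ^ 2 - C c) ^ 2 := by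
    have h1 : C (2 * c)⁻¹ * (2 * C c) = 1 := by
      rw [show (2 : ℝ[X]) = C 2 from rfl, ← C_mul, ← C_mul, inv_mul_cancel₀ (by simpa), C_1]
    have h3 : C (3 * c) = 3 * C c := C_mul
    rw [h3]
    linear_combination (C c * (C (2 * c)⁻¹ * (2 * C c) + 1)) * h1
  rw [ssPart, ← map_mul, h, map_add, map_mul, ha, mul_zero, add_zero, aeval_C]

theorem nilPart_mul_self (ha : aeval a ((X ^ 2 - C c) ^ 2) = 0) :
    nilPart c a * nilPart c a = 0 := by
  have h : (C (2 * c)⁻¹ * (X ^ 3 - C c * X)) * (C (2 * c)⁻¹ * (X ^ 3 - C c * X)) =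
      (C (2 * c)⁻¹ ^ 2 * X ^ 2) * (X ^ 2 - C c) ^ 2 := by ring
  rw [nilPart, ← map_mul, h, map_mul, ha, mul_zero]

end

end Polynomials

/-! ### Jordan–Chevalley decompositions of generalized polynomial structures -/

section JordanChevalley

variable {n : ℕ} {M : Type*} [TopologicalSpace M]
  [ChartedSpace (EuclideanSpace ℝ (Fin n)) M] [IsManifold (𝓡 n) ∞ M]

theorem IsGenPolyStructure.aeval_eq_zero {φ : GenEnd n M} {P : ℝ[X]} (h : IsGenPolyStructure φ P) :
    Polynomial.aeval φ P = 0 := by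
  refine ext_fibreMap fun p => ?_
  rw [← fibreMapHom_apply, ← fibreMapHom_apply, map_zero, ← Polynomial.aeval_algHom_apply,
    fibreMapHom_apply, ← h.minpoly_eq p, minpoly.aeval]

theorem IsSkew.tautInner_aeval {φ : GenEnd n M} (h : IsSkew φ) (Q : ℝ[X]) (x y : GenSec n M) :
    tautInner (Polynomial.aeval φ Q x) y = tautInner x (Polynomial.aeval (-φ) Q y) := by
  induction Q using Polynomial.induction_on' generalizing x y with
  | add p q hp hq =>
    rw [map_add, map_add, LinearMap.add_apply, LinearMap.add_apply, tautInner_add_left,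
      tautInner_add_right, hp, hq]
  | monomial k c =>
    have hk : ∀ (k : ℕ) (x y : GenSec n M), tautInner ((φ ^ k) x) y = tautInner x (((-φ) ^ k) y) := by
      intro k
      induction k with
      | zero => intro x y; rfl
      | succ k ih =>
        intro x y
        rw [pow_succ', pow_succ, Module.End.mul_apply, Module.End.mul_apply, ← ih,
          (isSkew_iff φ).1 h, LinearMap.neg_apply, tautInner_neg_right]
    simp only [Polynomial.aeval_monomial, Algebra.algebraMap_eq_smul_one, smul_mul_assoc, one_mul,
      LinearMap.smul_apply]
    rw [tautInner_smul_left, tautInner_smul_right, hk]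

/-- The minimal polynomial of a skew-symmetric endomorphism of even degree is even, as the adjoint
`-φ` is annihilated by the same polynomials. -/
theorem IsGenPolyStructure.comp_neg_X [T2Space M] {φ : GenEnd n M} {P : ℝ[X]} (h : IsGenPolyStructure φ P)
    (hdeg : Even P.natDegree) [Nonempty M] : P.comp (-Polynomial.X) = P := by
  obtain ⟨p⟩ := ‹Nonempty M›
  have h0 : Polynomial.aeval (-φ) P = 0 := by
    refine LinearMap.ext fun y => eq_zero_of_forall_tautInner fun x => ?_
    rw [tautInner_comm, ← h.skew.tautInner_aeval, h.aeval_eq_zero, LinearMap.zero_apply,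
      tautInner_comm, ← zero_smul ℝ (0 : GenSec n M), tautInner_smul_right, zero_smul]
  have h1 : Polynomial.aeval (fibreMap φ p) (P.comp (-Polynomial.X)) = 0 := by
    rw [Polynomial.aeval_comp, map_neg, Polynomial.aeval_X, ← fibreMapHom_apply, ← map_neg,
      Polynomial.aeval_algHom_apply, h0, map_zero]
  have h2 : P ∣ P.comp (-Polynomial.X) := by
    have := minpoly.dvd ℝ _ h1
    rwa [h.minpoly_eq] at this
  have hm : (P.comp (-Polynomial.X)).Monic := by
    rw [Polynomial.Monic, Polynomial.leadingCoeff_comp (by simp), h.monic.leadingCoeff]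
    simp [hdeg.neg_one_pow]
  refine (Polynomial.eq_of_monic_of_dvd_of_natDegree_le h.monic hm h2 ?_)
  simp [Polynomial.natDegree_comp]

theorem IsGenPolyStructure.eigenvalueSet_eq [T2Space M] {φ : GenEnd n M} {P : ℝ[X]}
    (h : IsGenPolyStructure φ P) [Nonempty M] :
    eigenvalueSet φ = {z : ℂ | Polynomial.aeval z P = 0} := by
  ext z
  constructor
  · rintro ⟨p, hp⟩
    obtain ⟨v, hv⟩ := hp.exists_hasEigenvector
    have h1 := Module.End.aeval_apply_of_hasEigenvector (p := P.map (algebraMap ℝ ℂ)) hv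
    have h2 : Polynomial.aeval ((fibreMap φ p).baseChange ℂ) (P.map (algebraMap ℝ ℂ)) = 0 := by
      rw [Polynomial.aeval_map_algebraMap]
      have := Polynomial.aeval_algHom_apply (Module.End.baseChangeHom ℝ ℂ (Fibre n p))
        (fibreMap φ p) P
      refine this.trans ?_
      rw [← h.minpoly_eq p, minpoly.aeval, map_zero]
    rw [h2, LinearMap.zero_apply] at h1
    have h3 := (smul_eq_zero.1 h1.symm).resolve_right hv.2
    rwa [Polynomial.eval_map_algebraMap] at h3
  · intro hz
    obtain ⟨p⟩ := ‹Nonempty M›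
    refine ⟨p, ?_⟩
    rw [Module.End.hasEigenvalue_iff_isRoot_charpoly, LinearMap.charpoly_baseChange,
      Polynomial.IsRoot, Polynomial.eval_map_algebraMap]
    obtain ⟨r, hr⟩ := LinearMap.minpoly_dvd_charpoly (fibreMap φ p)
    rw [hr, h.minpoly_eq, map_mul, hz, zero_mul]

/-- A generalized polynomial structure of degree four with exactly two eigenvalues has minimal
polynomial `(X² - c)²` with `c ≠ 0`. -/
theorem IsGenPolyStructure.exists_eq_sq [T2Space M] {φ : GenEnd n M} {P : ℝ[X]} (h : IsGenPolyStructure φ P)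
    (hdeg : P.natDegree = 4) (hev : (eigenvalueSet φ).ncard = 2) :
    ∃ c : ℝ, c ≠ 0 ∧ P = (Polynomial.X ^ 2 - Polynomial.C c) ^ 2 := by
  have hne : (eigenvalueSet φ).Nonempty := by
    refine Set.nonempty_of_ncard_ne_zero ?_
    omega
  obtain ⟨_, p, _⟩ := hne
  have : Nonempty M := ⟨p⟩
  refine exists_eq_sq_of_ncard_roots h.monic hdeg (h.comp_neg_X (by rw [hdeg]; decide)) ?_
  rw [← h.eigenvalueSet_eq, hev]

theorem IsJordanChevalley.unique [T2Space M] {φ s ν s' ν' : GenEnd n M} (h : IsJordanChevalley φ s ν)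
    (h' : IsJordanChevalley φ s' ν') : s = s' ∧ ν = ν' := by
  have hp : ∀ p : M, fibreMap ν p = fibreMap ν' p ∧ fibreMap s p = fibreMap s' p := by
    intro p
    refine Module.End.isNilpotent_isSemisimple_unique (h.nilpotent p) (h.semisimple p)
      (h'.nilpotent p) (h'.semisimple p) ((h.commute.map (fibreMapHom p)).symm)
      ((h'.commute.map (fibreMapHom p)).symm) ?_
    simp only [← fibreMapHom_apply, ← map_add]
    rw [add_comm, h.add_eq, add_comm, h'.add_eq]
  exact ⟨ext_fibreMap fun p => (hp p).2, ext_fibreMap fun p => (hp p).1⟩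

theorem isJordanChevalley_of_sq {s ν : GenEnd n M} {c : ℝ} (hc : c ≠ 0) (hcomm : Commute s ν)
    (hs : s * s = algebraMap ℝ (GenEnd n M) c) (hν : ν * ν = 0) :
    IsJordanChevalley (s + ν) s ν where
  add_eq := rfl
  commute := hcomm
  semisimple p := by
    refine Module.End.isSemisimple_of_squarefree_aeval_eq_zero
      (Polynomial.separable_X_pow_sub_C c (n := 2) (by norm_num) hc).squarefree ?_
    rw [map_sub, map_pow, Polynomial.aeval_X, Polynomial.aeval_C, pow_two, ← fibreMapHom_apply,
      ← map_mul, hs, AlgHom.commutes, sub_self]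
  nilpotent p := ⟨2, by rw [pow_two, ← fibreMapHom_apply, ← map_mul, hν, map_zero]⟩

theorem isJordanChevalley_ssPart_nilPart {φ : GenEnd n M} {c : ℝ} (hc : c ≠ 0)
    (hφ : Polynomial.aeval φ ((Polynomial.X ^ 2 - Polynomial.C c) ^ 2) = 0) :
    IsJordanChevalley φ (ssPart c φ) (nilPart c φ) := by
  have hs : ssPart c φ * ssPart c φ = algebraMap ℝ (GenEnd n M) c := ssPart_mul_self hc hφ
  have hν : nilPart c φ * nilPart c φ = 0 := nilPart_mul_self hφ
  have := isJordanChevalley_of_sq hc commute_ssPart_nilPart hs hν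
  rwa [ssPart_add_nilPart hc] at this

theorem IsSkew.aeval_of_comp_neg_X {φ : GenEnd n M} (h : IsSkew φ) {Q : ℝ[X]}
    (hQ : Q.comp (-Polynomial.X) = -Q) : IsSkew (Polynomial.aeval φ Q) := by
  rw [isSkew_iff]
  intro x y
  have e : Polynomial.aeval (-φ) Q = -Polynomial.aeval φ Q := by
    have e1 := congrArg (Polynomial.aeval φ) hQ
    have e2 : Polynomial.aeval φ (-Polynomial.X : ℝ[X]) = -φ := by simp
    rw [Polynomial.aeval_comp, e2] at e1
    rw [e1]
    simp
  rw [h.tautInner_aeval, e, LinearMap.neg_apply, tautInner_neg_right]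

theorem IsSkew.ssPart {φ : GenEnd n M} (h : IsSkew φ) (c : ℝ) : IsSkew (ssPart c φ) :=
  h.aeval_of_comp_neg_X (by simp; ring)

theorem IsSkew.nilPart {φ : GenEnd n M} (h : IsSkew φ) (c : ℝ) : IsSkew (nilPart c φ) :=
  h.aeval_of_comp_neg_X (by simp; ring)

theorem IsSkew.add {φ ψ : GenEnd n M} (h : IsSkew φ) (h' : IsSkew ψ) : IsSkew (φ + ψ) := by
  intro x y
  rw [LinearMap.add_apply, LinearMap.add_apply, tautInner_add_left, tautInner_add_right]
  linear_combination h x y + h' x y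

end JordanChevalley

/-! ### Minimality, and pairs of generalized structures -/

section Pairs

variable {n : ℕ} {M : Type*} [TopologicalSpace M]
  [ChartedSpace (EuclideanSpace ℝ (Fin n)) M] [IsManifold (𝓡 n) ∞ M]

theorem IsGenPolyStructure.isMinimal_iff [T2Space M] {φ s ν : GenEnd n M} {c : ℝ} (hc : c ≠ 0)
    (h : IsGenPolyStructure φ ((Polynomial.X ^ 2 - Polynomial.C c) ^ 2))
    (hφ : s + ν = φ) (hcomm : Commute s ν)
    (hs : s * s = algebraMap ℝ (GenEnd n M) c) (hν : ν * ν = 0) :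
    IsMinimal φ ((Polynomial.X ^ 2 - Polynomial.C c) ^ 2) ↔
      IsGenNijenhuis s ∧ IsGenNijenhuis ν := by
  constructor
  · rintro ⟨-, Φ, hΦ, h0⟩
    exact (derivedBracket_minimalOperator_eq_zero_iff hΦ hc hφ hcomm hs hν).1 h0
  · intro h0
    obtain ⟨Φ, hΦ⟩ := exists_isLift h.skew
    exact ⟨h, Φ, hΦ, (derivedBracket_minimalOperator_eq_zero_iff hΦ hc hφ hcomm hs hν).2 h0⟩

theorem sq_add_one_sq_eq :
    ((Polynomial.X : ℝ[X]) ^ 2 + 1) ^ 2 = (Polynomial.X ^ 2 - Polynomial.C (-1)) ^ 2 := by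
  rw [Polynomial.C_neg, Polynomial.C_1, sub_neg_eq_add]

theorem irreducible_X_sq_add_one : Irreducible ((Polynomial.X : ℝ[X]) ^ 2 + 1) := by
  have hm : ((Polynomial.X : ℝ[X]) ^ 2 + 1).Monic := by monicity!
  have hd : ((Polynomial.X : ℝ[X]) ^ 2 + 1).natDegree = 2 := by compute_degree!
  rw [hm.irreducible_iff_roots_eq_zero_of_degree_le_three (by omega) (by omega)]
  refine Multiset.eq_zero_of_forall_notMem fun x hx => ?_
  have h := Polynomial.isRoot_of_mem_roots hx
  rw [Polynomial.IsRoot] at h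
  simp only [Polynomial.eval_add, Polynomial.eval_pow, Polynomial.eval_X, Polynomial.eval_one] at h
  nlinarith [sq_nonneg x]

/-- For commuting `J₁`, `J₂` with `J₁² = -1` and `J₂² = 0`, the minimal polynomial of `J₁ + J₂` is
`(X² + 1)²` exactly when that of `J₂` is `X²`. -/
theorem minpoly_add_eq_iff {V : Type*} [AddCommGroup V] [Module ℝ V] {J₁ J₂ : Module.End ℝ V}
    (hcomm : J₁ * J₂ = J₂ * J₁) (h₁ : J₁ * J₁ = -1) (h₂ : J₂ * J₂ = 0) :
    minpoly ℝ (J₁ + J₂) = (Polynomial.X ^ 2 + 1) ^ 2 ↔ minpoly ℝ J₂ = Polynomial.X ^ 2 := by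
  have e : Polynomial.aeval (J₁ + J₂) ((Polynomial.X : ℝ[X]) ^ 2 + 1) = (2 : ℝ) • (J₁ * J₂) := by
    rw [map_add, map_pow, Polynomial.aeval_X, map_one, two_smul, pow_two, mul_add, add_mul, add_mul,
      h₁, h₂, ← hcomm]
    abel
  have e0 : Polynomial.aeval (J₁ + J₂) (((Polynomial.X : ℝ[X]) ^ 2 + 1) ^ 2) = 0 := by
    have : J₁ * J₂ * (J₁ * J₂) = 0 := by
      rw [mul_assoc, ← mul_assoc J₂, ← hcomm, mul_assoc J₁ J₂, h₂, mul_zero, mul_zero]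
    rw [map_pow, e, pow_two, smul_mul_assoc, mul_smul_comm, this, smul_zero, smul_zero]
  rw [minpoly_eq_sq_iff irreducible_X_sq_add_one (by monicity!) e0,
    minpoly_eq_sq_iff Polynomial.irreducible_X Polynomial.monic_X
      (by rw [map_pow, Polynomial.aeval_X, pow_two, h₂]), e, Polynomial.aeval_X]
  refine not_congr ⟨fun h => ?_, fun h => by rw [h, mul_zero, smul_zero]⟩
  have h' : J₁ * J₂ = 0 := (smul_eq_zero.1 h).resolve_left two_ne_zero
  have : J₁ * (J₁ * J₂) = -J₂ := by rw [← mul_assoc, h₁, neg_one_mul]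
  rw [h', mul_zero] at this
  exact (neg_eq_zero.1 this.symm)

theorem algebraMap_neg_one_genEnd : algebraMap ℝ (GenEnd n M) (-1) = -1 := by
  refine LinearMap.ext fun x => ?_
  exact neg_one_smul ℝ x

/-- The minimal polynomial of `J₁ + J₂` on the fibres, for commuting `J₁`, `J₂` with `J₁² = -1` and
`J₂² = 0`. -/
theorem minpoly_fibreMap_add_eq_iff {J₁ J₂ : GenEnd n M} (hcomm : Commute J₁ J₂)
    (h₁ : J₁ * J₁ = -1) (h₂ : J₂ * J₂ = 0) (p : M) :
    minpoly ℝ (fibreMap (J₁ + J₂) p) = (Polynomial.X ^ 2 + 1) ^ 2 ↔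
      minpoly ℝ (fibreMap J₂ p) = Polynomial.X ^ 2 := by
  have e : fibreMap (J₁ + J₂) p = fibreMap J₁ p + fibreMap J₂ p := by
    simp only [← fibreMapHom_apply, map_add]
  rw [e]
  refine minpoly_add_eq_iff ?_ ?_ ?_ <;> simp only [← fibreMapHom_apply, ← map_mul]
  · rw [hcomm.eq]
  · rw [h₁, ← algebraMap_neg_one_genEnd, AlgHom.commutes, map_neg, map_one]
  · rw [h₂, map_zero]

/-- The semisimple and nilpotent parts of a minimal structure with minimal polynomial `(X² + 1)²`. -/
theorem IsMinimal.parts [T2Space M] {φ : GenEnd n M}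
    (h : IsMinimal φ (((Polynomial.X : ℝ[X]) ^ 2 + 1) ^ 2)) :
    IsGenComplex (ssPart (-1) φ) ∧ IsWeakGenTangent (nilPart (-1) φ) ∧
      Commute (ssPart (-1) φ) (nilPart (-1) φ) ∧
      IsJordanChevalley φ (ssPart (-1) φ) (nilPart (-1) φ) := by
  have hc : (-1 : ℝ) ≠ 0 := by norm_num
  have h0 := h.1.aeval_eq_zero
  have h' := h
  rw [sq_add_one_sq_eq] at h0 h'
  have hJC := isJordanChevalley_ssPart_nilPart hc h0
  have hs : ssPart (-1) φ * ssPart (-1) φ = algebraMap ℝ (GenEnd n M) (-1) := ssPart_mul_self hc h0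
  have hν : nilPart (-1) φ * nilPart (-1) φ = 0 := nilPart_mul_self h0
  obtain ⟨N1, N2⟩ := (h'.1.isMinimal_iff hc hJC.add_eq hJC.commute hs hν).1 h'
  rw [algebraMap_neg_one_genEnd] at hs
  refine ⟨⟨h.1.skew.ssPart _, hs, N1⟩, ⟨⟨h.1.skew.nilPart _, Polynomial.monic_X_pow 2, by simp,
    fun p => ?_⟩, N2⟩, hJC.commute, hJC⟩
  rw [← minpoly_fibreMap_add_eq_iff hJC.commute hs hν, hJC.add_eq, h.1.minpoly_eq]

/-- The sum of a commuting pair consisting of a generalized complex and a weak generalized tangent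
structure. -/
theorem isMinimal_add [T2Space M] {J₁ J₂ : GenEnd n M} (h₁ : IsGenComplex J₁)
    (h₂ : IsWeakGenTangent J₂) (hcomm : Commute J₁ J₂) :
    IsMinimal (J₁ + J₂) (((Polynomial.X : ℝ[X]) ^ 2 + 1) ^ 2) ∧
      IsJordanChevalley (J₁ + J₂) J₁ J₂ := by
  have hc : (-1 : ℝ) ≠ 0 := by norm_num
  have hν : J₂ * J₂ = 0 := by
    have := h₂.polyStructure.aeval_eq_zero
    rwa [map_pow, Polynomial.aeval_X, pow_two] at this
  have hs : J₁ * J₁ = algebraMap ℝ (GenEnd n M) (-1) := by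
    rw [h₁.sq, algebraMap_neg_one_genEnd]
  have hpoly : IsGenPolyStructure (J₁ + J₂) (((Polynomial.X : ℝ[X]) ^ 2 + 1) ^ 2) := by
    refine ⟨h₁.skew.add h₂.polyStructure.skew, by monicity!, ?_, fun p => ?_⟩
    · have : (((Polynomial.X : ℝ[X]) ^ 2 + 1) ^ 2).natDegree = 4 := by compute_degree!
      omega
    · rw [minpoly_fibreMap_add_eq_iff hcomm h₁.sq hν, h₂.polyStructure.minpoly_eq]
  refine ⟨?_, isJordanChevalley_of_sq hc hcomm hs hν⟩
  rw [sq_add_one_sq_eq] at hpoly ⊢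
  exact (hpoly.isMinimal_iff hc rfl hcomm hs hν).2 ⟨h₁.nijenhuis, h₂.nijenhuis⟩

end Pairs

end GenGeom

theorem mainTheorem10 (n : ℕ) (M : Type*) [TopologicalSpace M] [T2Space M] [SigmaCompactSpace M]
    [ChartedSpace (EuclideanSpace ℝ (Fin n)) M] [IsManifold (𝓡 n) ∞ M] :
    (∀ (φ : GenGeom.GenEnd n M) (P : ℝ[X]), GenGeom.IsGenPolyStructure φ P →
      P.natDegree = 4 → (GenGeom.eigenvalueSet φ).ncard = 2 →
        (∃! q : GenGeom.GenEnd n M × GenGeom.GenEnd n M,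
          GenGeom.IsJordanChevalley φ q.1 q.2) ∧
        ∀ s ν : GenGeom.GenEnd n M, GenGeom.IsJordanChevalley φ s ν →
          (GenGeom.IsMinimal φ P ↔ GenGeom.IsGenNijenhuis s ∧ GenGeom.IsGenNijenhuis ν)) ∧
    (∃ F : {φ : GenGeom.GenEnd n M //
            GenGeom.IsMinimal φ (((Polynomial.X : ℝ[X]) ^ 2 + 1) ^ 2)} ≃
          {J : GenGeom.GenEnd n M × GenGeom.GenEnd n M //
            GenGeom.IsGenComplex J.1 ∧ GenGeom.IsWeakGenTangent J.2 ∧ Commute J.1 J.2},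
      ∀ φ, GenGeom.IsJordanChevalley φ.1 (F φ).1.1 (F φ).1.2) := by
  refine ⟨fun φ P hP hdeg hev => ?_, ?_⟩
  · obtain ⟨c, hc, rfl⟩ := hP.exists_eq_sq hdeg hev
    have h0 := hP.aeval_eq_zero
    have hJC := GenGeom.isJordanChevalley_ssPart_nilPart hc h0
    refine ⟨⟨(_, _), hJC, fun q hq => ?_⟩, fun s ν h => ?_⟩
    · obtain ⟨h1, h2⟩ := hq.unique hJC
      exact Prod.ext h1 h2
    · obtain ⟨rfl, rfl⟩ := h.unique hJC
      exact hP.isMinimal_iff hc hJC.add_eq hJC.commute (GenGeom.ssPart_mul_self hc h0)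
        (GenGeom.nilPart_mul_self h0)
  · refine ⟨⟨fun φ => ⟨(GenGeom.ssPart (-1) φ.1, GenGeom.nilPart (-1) φ.1), φ.2.parts.1,
        φ.2.parts.2.1, φ.2.parts.2.2.1⟩,
      fun J => ⟨J.1.1 + J.1.2, (GenGeom.isMinimal_add J.2.1 J.2.2.1 J.2.2.2).1⟩,
      fun φ => Subtype.ext φ.2.parts.2.2.2.add_eq, fun J => ?_⟩, fun φ => φ.2.parts.2.2.2⟩
    have hmin := GenGeom.isMinimal_add J.2.1 J.2.2.1 J.2.2.2
    obtain ⟨h1, h2⟩ := hmin.1.parts.2.2.2.unique hmin.2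
    exact Subtype.ext (Prod.ext h1 h2)
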